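/- Let $m\ge 1$ and let $H^m$ be the Heisenberg group, i.e. $\mathbb R^{2m+1}$ with points $q=(x,y,t)$, $x,y\in\mathbb R^m$, $t\in\mathbb R$, and with the left-invariant vector fields $$X_j=\partial_{x_j}+2y_j\,\partial_t,\qquad Y_j=\partial_{y_j}-2x_j\,\partial_t\qquad(1\le j\le m).$$ For $u\in C^1(H^m)$ let $\nabla_{H^m}u=(X_1u,\dots,X_mu,Y_1u,\dots,Y_mu)$, with the Euclidean inner product and norm on these components. Let $p>1$ and $\varphi(t)=t^{p-1}$ for $t\ge 0$. Let $f,g:[0,\infty)\to\mathbb R$ and $h:(0,\infty)\to\mathbb R$ be such that * (F) $f$ is continuous and non-decreasing on $[0,\infty)$ and $f>0$ on $(0,\infty)$; * (H) $h$ is continuous, non-negative and non-increasing on $(0,\infty)$, and integrable near $0$; moreover $h\in L^1(0,\infty)$; * (G) with $\tau=0$: $g$ is continuous and non-negative, and for some $\widetilde D>0$, $\;g(st)\le \widetilde D\, s\, t^2\varphi'(t)$ for all $s\in[0,1]$, $t>0$. Assume also the following two conditions, both of which in fact hold automatically for $\varphi(t)=t^{p-1}$: * ($\Phi2$) with $\tau=0$: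 for some $D>0$, $\;s\varphi'(st)\le D\varphi'(t)$ for all $s\in[0,1]$, $t>0$ (the left-hand side being $0$ for $s=0$); * ($\Phi3$) for some $B>0$ and $\theta<2$, $\;\varphi'(ts)\ge B\varphi'(t)s^{-\theta}$ for all $t>0$, $s\ge1$. Put $K(t)=\int_0^t s\varphi'(s)\,ds$, let $K^{-1}:[0,\infty)\to[0,\infty)$ be its inverse on $[0,\infty)$, and let $F(t)=\int_0^t f(s)\,ds$. A non-negative solution $u\in C^1(H^m)$ of $\Delta^p_{H^m}u\ge f(u)-h(u)g(|\nabla_{H^m}u|)$ is understood weakly: $f(u)-h(u)g(|\nabla_{H^m}u|)\in L^1_{\mathrm{loc}}$, and for every $\zeta\in C_0^\infty(H^m)$ with $\zeta\ge0$, $$-\int_{\mathbb R^{2m+1}}|\nabla_{H^m}u|^{p-2}\,\nabla_{H^m}u\cdot\nabla_{H^m}\zeta\;\ge\;\int_{\mathbb R^{2m+1}}\bigl(f(u)-h(u)g(|\nabla_{H^m}u|)\bigr)\zeta ,$$ where $|\nabla_{H^m}u|^{p-2}\nabla_{H^m}u$ is read as $0$ where $\nabla_{H^m}u=0$, and $h(u)g(|\nabla_{H^m}u|)$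 is read as $0$ where $u=0$ (at such points $\nabla_{H^m}u=0$, and $g(0)=0$ by (G)). Then the following are equivalent: 1. there exists a non-negative, non-constant solution $u\in C^1(H^m)$ of $\Delta^p_{H^m}u\ge f(u)-h(u)g(|\nabla_{H^m}u|)$ on $H^m$; 2. $\dfrac{1}{K^{-1}(F(t))}\notin L^1(+\infty)$, i.e. this function is not integrable on any neighbourhood of $+\infty$. -/

import Mathlib

open MeasureTheory Set Filter Topology
open scoped ContDiff

namespace HeisenbergKO

/-- The manifold underlying the Heisenberg group `H^m`, that is `ℝ^(2m+1)` with points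
`q = (x, y, t)`, `x, y ∈ ℝ^m`, `t ∈ ℝ`.  Its `volume` is Lebesgue measure. -/
abbrev Heis (m : ℕ) : Type := (Fin m → ℝ) × (Fin m → ℝ) × ℝ

/-- The left-invariant field `X_j = ∂/∂x_j + 2 y_j ∂/∂t` applied to `u` at `q`. -/
noncomputable def fieldX {m : ℕ} (j : Fin m) (u : Heis m → ℝ) (q : Heis m) : ℝ :=
  fderiv ℝ u q (Pi.single j 1, 0, 2 * q.2.1 j)

/-- The left-invariant field `Y_j = ∂/∂y_j - 2 x_j ∂/∂t` applied to `u` at `q`. -/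
noncomputable def fieldY {m : ℕ} (j : Fin m) (u : Heis m → ℝ) (q : Heis m) : ℝ :=
  fderiv ℝ u q (0, Pi.single j 1, -(2 * q.1 j))

/-- The Heisenberg gradient, given by its coefficients in the frame
`X_1, …, X_m, Y_1, …, Y_m`; the `·` product of the frame is the Euclidean inner product. -/
noncomputable def gradH {m : ℕ} (u : Heis m → ℝ) (q : Heis m) :
    EuclideanSpace ℝ (Fin m ⊕ Fin m) :=
  WithLp.toLp 2 (Sum.elim (fun j => fieldX j u q) (fun j => fieldY j u q))

/-- `u` is an entire weak classical solution on `H^m` of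
`Δ^φ u ≥ f(u) - h(u) g(|∇_H u|)`: `u` is `C^1`, the right-hand side is locally integrable, and
`-∫ |∇_H u|⁻¹ φ(|∇_H u|) ∇_H u · ∇_H ζ ≥ ∫ (f(u) - h(u) g(|∇_H u|)) ζ`
for all non-negative `ζ ∈ C_0^∞(H^m)`. -/
structure IsWeakSolution {m : ℕ} (φ f h g : ℝ → ℝ) (u : Heis m → ℝ) : Prop where
  contDiff : ContDiff ℝ 1 u
  locallyIntegrable :
    LocallyIntegrable (fun q => f (u q) - h (u q) * g ‖gradH u q‖) volume
  weak_ineq : ∀ ζ : Heis m → ℝ, ContDiff ℝ ∞ ζ → HasCompactSupport ζ → (∀ q, 0 ≤ ζ q) →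
    ∫ q, (f (u q) - h (u q) * g ‖gradH u q‖) * ζ q ≤
      -∫ q, ‖gradH u q‖⁻¹ * φ ‖gradH u q‖ * inner ℝ (gradH u q) (gradH ζ q)

/-- The function `φ(t) = t^(p-1)`, `t ≥ 0`, for which `Δ^φ` is the `p`-Laplacian. -/
noncomputable def phiP (p : ℝ) (t : ℝ) : ℝ := t ^ (p - 1)

/-- Condition (F): `f` is continuous and increasing (in the wide sense) on `[0, ∞)` and
positive on `(0, ∞)`. -/
structure CondF (f : ℝ → ℝ) : Prop where
  continuousOn : ContinuousOn f (Ici 0)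
  pos : ∀ t, 0 < t → 0 < f t
  monotoneOn : MonotoneOn f (Ici 0)

/-- Condition (H): `h` is continuous, non-negative and non-increasing on `(0, ∞)`, and
integrable near `0`. -/
structure CondH (h : ℝ → ℝ) : Prop where
  continuousOn : ContinuousOn h (Ioi 0)
  nonneg : ∀ t, 0 < t → 0 ≤ h t
  antitoneOn : AntitoneOn h (Ioi 0)
  integrableAtZero : IntegrableAtFilter h (𝓝[>] 0) volume

/-- Condition (Φ2): `s φ'(st) ≤ D s^τ φ'(t)`. -/
def CondPhi2 (φ : ℝ → ℝ) (τ : ℝ) : Prop :=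
  ∃ D : ℝ, 0 < D ∧ ∀ s ∈ Icc (0 : ℝ) 1, ∀ t : ℝ, 0 < t →
    s * deriv φ (s * t) ≤ D * s ^ τ * deriv φ t

/-- Condition (Φ3): `φ'(ts) ≥ B φ'(t) s^(-θ)`. -/
def CondPhi3 (φ : ℝ → ℝ) : Prop :=
  ∃ B θ : ℝ, 0 < B ∧ θ < 2 ∧ ∀ t : ℝ, 0 < t → ∀ s : ℝ, 1 ≤ s →
    B * deriv φ t * s ^ (-θ) ≤ deriv φ (t * s)

/-- Condition (G): `g(st) ≤ D s^(τ+1) t² φ'(t)`. -/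
def CondG (φ : ℝ → ℝ) (τ : ℝ) (g : ℝ → ℝ) : Prop :=
  ∃ D : ℝ, 0 < D ∧ ∀ s ∈ Icc (0 : ℝ) 1, ∀ t : ℝ, 0 < t →
    g (s * t) ≤ D * s ^ (τ + 1) * t ^ 2 * deriv φ t

/-- `K(t) = ∫_0^t s φ'(s) ds`. -/
noncomputable def K (φ : ℝ → ℝ) (t : ℝ) : ℝ := ∫ s in (0 : ℝ)..t, s * deriv φ s

/-- The inverse of `K : [0, ∞) → [0, ∞)`. -/
noncomputable def Kinv (φ : ℝ → ℝ) : ℝ → ℝ := Function.invFunOn (K φ) (Ici 0)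

/-- `F(t) = ∫_0^t f(s) ds`. -/
noncomputable def primF (f : ℝ → ℝ) (t : ℝ) : ℝ := ∫ s in (0 : ℝ)..t, f s

/-- The Keller-Osserman condition `1 / K⁻¹(F(t)) ∈ L^1(+∞)`. -/
def KellerOsserman (φ f : ℝ → ℝ) : Prop :=
  IntegrableAtFilter (fun t => 1 / Kinv φ (primF f t)) atTop volume

end HeisenbergKO

open HeisenbergKO

/-!
Existence: a profile `w(x_j)` of one horizontal coordinate solves `Δ^p u = f(u)` as soon as
`w' = |V|^(q-2) V` and `V' = f(w)`, where `1/p + 1/q = 1`. This system has the first integral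
`|V|^q / q = ∫_1^w f`, and its solutions exist on the whole line exactly when `1 / K⁻¹(F)` is not
integrable at infinity.

Nonexistence: by (G) the gradient term is at most `C h(u) |∇u|^p`, and replacing `u` by `Ψ(u)`,
where `Ψ' = exp(C ∫_0^u h)^(1/(p-1))`, absorbs it. As `h` is integrable, `Ψ'` stays between two
positive constants and the Keller-Osserman condition is preserved, so it suffices to treat
`Δ^p v ≥ f(v)`. Such a `v` is compared with `b + c N^λ`, where `N = |z|⁴ + t²`: bounded `v` vanish,
and if `v` reaches the value `a` in `{N ≤ L}` then it reaches `2a` in `{N ≤ L 5^s}`, where `s^p` is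
a constant multiple of `a^(p-1) / f(a)`. Along `a = 2^k` the Keller-Osserman condition says that
these `s` are summable, so a non-zero `v` would be unbounded on a compact set.
-/

namespace HeisenbergKO

section Flux

variable {V : Type*} [NormedAddCommGroup V] [InnerProductSpace ℝ V] {φ : ℝ → ℝ}

/-- The flux `|a|⁻¹ φ(|a|) a` of the `φ`-Laplacian, equal to `0` at `a = 0`. -/
noncomputable def flux (φ : ℝ → ℝ) (a : V) : V := (‖a‖⁻¹ * φ ‖a‖) • a

@[simp] lemma flux_zero (φ : ℝ → ℝ) : flux φ (0 : V) = 0 := smul_zero _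

lemma norm_flux_of_ne_zero {a : V} (ha : a ≠ 0) : ‖flux φ a‖ = |φ ‖a‖| := by
  rw [flux, norm_smul, norm_mul, norm_inv, norm_norm, Real.norm_eq_abs]
  field_simp [norm_ne_zero_iff.2 ha]

lemma norm_flux_le {a : V} (h : 0 ≤ φ ‖a‖) : ‖flux φ a‖ ≤ φ ‖a‖ := by
  rcases eq_or_ne a 0 with rfl | ha
  · simpa using h
  · rw [norm_flux_of_ne_zero ha, abs_of_nonneg h]

lemma inner_flux_self (φ : ℝ → ℝ) (a : V) : inner ℝ (flux φ a) a = φ ‖a‖ * ‖a‖ := by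
  rcases eq_or_ne a 0 with rfl | ha
  · simp
  · have := norm_ne_zero_iff.2 ha
    rw [flux, real_inner_smul_left, real_inner_self_eq_norm_sq]
    field_simp

lemma continuous_flux (hφ : ContinuousOn φ (Ici 0)) (h0 : φ 0 = 0) :
    Continuous (flux φ : V → V) := by
  have hnorm : Continuous fun a : V => φ ‖a‖ :=
    hφ.comp_continuous continuous_norm fun a => norm_nonneg a
  refine continuous_iff_continuousAt.2 fun a => ?_
  rcases eq_or_ne a 0 with rfl | ha
  · have hlim : Tendsto (fun a : V => |φ ‖a‖|) (𝓝 0) (𝓝 0) := by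
      simpa [h0] using (hnorm.abs).tendsto (0 : V)
    rw [ContinuousAt, flux_zero, tendsto_zero_iff_norm_tendsto_zero]
    refine squeeze_zero (fun _ => norm_nonneg _) (fun b => ?_) hlim
    rcases eq_or_ne b 0 with rfl | hb
    · simp
    · exact (norm_flux_of_ne_zero hb).le
  · exact ((continuousAt_id.norm.inv₀ (norm_ne_zero_iff.2 ha)).mul hnorm.continuousAt).smul
      continuousAt_id

lemma inner_flux_sub_nonneg (hφ : MonotoneOn φ (Ici 0)) (h0 : 0 ≤ φ 0) (a b : V) :
    0 ≤ inner ℝ (flux φ a - flux φ b) (a - b) := by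
  have hcross : ∀ c d : V, inner ℝ (flux φ c) d ≤ φ ‖c‖ * ‖d‖ := fun c d =>
    (real_inner_le_norm _ _).trans <| mul_le_mul_of_nonneg_right
      (norm_flux_le <| h0.trans <| hφ self_mem_Ici (norm_nonneg c) (norm_nonneg c))
      (norm_nonneg d)
  have hmono : 0 ≤ (φ ‖a‖ - φ ‖b‖) * (‖a‖ - ‖b‖) := by
    rcases le_total ‖a‖ ‖b‖ with h | h
    · exact mul_nonneg_of_nonpos_of_nonpos
        (sub_nonpos.2 <| hφ (norm_nonneg a) (norm_nonneg b) h) (sub_nonpos.2 h)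
    · exact mul_nonneg
        (sub_nonneg.2 <| hφ (norm_nonneg b) (norm_nonneg a) h) (sub_nonneg.2 h)
  rw [inner_sub_left, inner_sub_right, inner_sub_right, inner_flux_self, inner_flux_self]
  linarith [hcross a b, hcross b a]

end Flux

section PowerFlux

variable {V : Type*} [NormedAddCommGroup V] [InnerProductSpace ℝ V] {p : ℝ}

lemma phiP_zero (hp : p ≠ 1) : phiP p 0 = 0 := Real.zero_rpow (sub_ne_zero.2 hp)

lemma phiP_nonneg (p : ℝ) {t : ℝ} (ht : 0 ≤ t) : 0 ≤ phiP p t := Real.rpow_nonneg ht _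

lemma continuous_phiP (hp : 1 ≤ p) : Continuous (phiP p) :=
  Real.continuous_rpow_const (sub_nonneg.2 hp)

lemma monotoneOn_phiP (hp : 1 ≤ p) : MonotoneOn (phiP p) (Ici 0) :=
  Real.monotoneOn_rpow_Ici_of_exponent_nonneg (sub_nonneg.2 hp)

lemma continuous_flux_phiP (hp : 1 < p) : Continuous (flux (phiP p) : V → V) :=
  continuous_flux (continuous_phiP hp.le).continuousOn (phiP_zero hp.ne')

lemma norm_flux_phiP (hp : p ≠ 1) (a : V) : ‖flux (phiP p) a‖ = ‖a‖ ^ (p - 1) := by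
  rcases eq_or_ne a 0 with rfl | ha
  · simp [Real.zero_rpow (sub_ne_zero.2 hp)]
  · rw [norm_flux_of_ne_zero ha, abs_of_nonneg (phiP_nonneg p (norm_nonneg a)), phiP]

lemma flux_phiP_eq_smul (p : ℝ) (a : V) : flux (phiP p) a = ‖a‖ ^ (p - 2) • a := by
  rcases eq_or_ne a 0 with rfl | ha
  · simp
  · rw [flux, phiP, show p - 2 = p - 1 - 1 by ring,
      Real.rpow_sub_one (norm_ne_zero_iff.2 ha) (p - 1), div_eq_inv_mul]

lemma flux_phiP_smul (p : ℝ) {s : ℝ} (hs : 0 < s) (a : V) :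
    flux (phiP p) (s • a) = s ^ (p - 1) • flux (phiP p) a := by
  rw [flux_phiP_eq_smul, flux_phiP_eq_smul, norm_smul, Real.norm_of_nonneg hs.le,
    Real.mul_rpow hs.le (norm_nonneg a), smul_smul, smul_smul, mul_right_comm,
    ← Real.rpow_add_one hs.ne', show p - 2 + 1 = p - 1 by ring]

lemma inner_flux_phiP_self (hp : p ≠ 0) (a : V) : inner ℝ (flux (phiP p) a) a = ‖a‖ ^ p := by
  rw [inner_flux_self, phiP]
  rcases eq_or_ne a 0 with rfl | ha
  · simp [Real.zero_rpow hp]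
  · rw [← Real.rpow_add_one (norm_ne_zero_iff.2 ha), sub_add_cancel]

lemma flux_phiP_flux_phiP {q : ℝ} (hpq : p.HolderConjugate q) (a : V) :
    flux (phiP p) (flux (phiP q) a) = a := by
  rcases eq_or_ne a 0 with rfl | ha
  · simp
  · have hexp : (q - 1) * (p - 2) + (q - 2) = 0 := by linear_combination hpq.mul_eq_add
    rw [flux_phiP_eq_smul, norm_flux_phiP hpq.symm.lt.ne', flux_phiP_eq_smul, smul_smul,
      ← Real.rpow_mul (norm_nonneg a), ← Real.rpow_add (norm_pos_iff.2 ha), hexp, Real.rpow_zero,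
      one_smul]

end PowerFlux

section Divergence

variable {E : Type*} [NormedAddCommGroup E] [NormedSpace ℝ E]

/-- The divergence of a vector field, defined without reference to coordinates as the trace of its
derivative. -/
noncomputable def divergence (W : E → E) (q : E) : ℝ := LinearMap.trace ℝ E (fderiv ℝ W q)

lemma divergence_add {W W' : E → E} {q : E} (hW : DifferentiableAt ℝ W q)
    (hW' : DifferentiableAt ℝ W' q) :
    divergence (fun x => W x + W' x) q = divergence W q + divergence W' q := by
  rw [divergence, fderiv_fun_add hW hW']
  simp [divergence]

lemma divergence_eq_sum {ι : Type*} [Fintype ι] (b : Module.Basis ι ℝ E) (W : E → E) (q : E) :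
    divergence W q = ∑ i, b.coord i (fderiv ℝ W q (b i)) := by
  classical
  rw [divergence, LinearMap.trace_eq_matrix_trace ℝ b, Matrix.trace]
  simp [LinearMap.toMatrix_apply]

variable [FiniteDimensional ℝ E]

lemma divergence_smul {G : E → ℝ} {W : E → E} {q : E} (hG : DifferentiableAt ℝ G q)
    (hW : DifferentiableAt ℝ W q) :
    divergence (fun x => G x • W x) q = G q * divergence W q + fderiv ℝ G q (W q) := by
  rw [divergence, fderiv_fun_smul hG hW]
  simp [divergence]

lemma continuous_divergence {W : E → E} (hW : ContDiff ℝ 1 W) : Continuous (divergence W) :=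
  (LinearMap.continuous_of_finiteDimensional
    ((LinearMap.trace ℝ E).comp (ContinuousLinearMap.coeLM ℝ))).comp
    (hW.continuous_fderiv one_ne_zero)

lemma integral_fderiv_apply_eq_neg_integral_divergence_mul [MeasurableSpace E] [BorelSpace E]
    (μ : Measure E) [μ.IsAddHaarMeasure] {W : E → E} {ζ : E → ℝ} (hW : ContDiff ℝ 1 W)
    (hζ : ContDiff ℝ 1 ζ) (hc : HasCompactSupport ζ) :
    ∫ q, fderiv ℝ ζ q (W q) ∂μ = -∫ q, divergence W q * ζ q ∂μ := by
  let b := Module.finBasis ℝ E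
  let c i : E → ℝ := fun q => b.coord i (W q)
  have hcoord : ∀ i, ContDiff ℝ 1 (c i) := fun i =>
    (LinearMap.toContinuousLinearMap (b.coord i)).contDiff.comp hW
  have hdiv : ∀ q, divergence W q = ∑ i, fderiv ℝ (c i) q (b i) := fun q => by
    rw [divergence_eq_sum b]
    refine Finset.sum_congr rfl fun i _ => ?_
    have h := ((LinearMap.toContinuousLinearMap (b.coord i)).hasFDerivAt.comp q
      (hW.differentiable one_ne_zero q).hasFDerivAt).fderiv
    exact (congrArg (fun l : E →L[ℝ] ℝ => l (b i)) h).symm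
  have hdir : ∀ q, fderiv ℝ ζ q (W q) = ∑ i, c i q * fderiv ℝ ζ q (b i) := fun q => by
    conv_lhs => rw [← b.sum_repr (W q), map_sum]
    simp only [map_smul, smul_eq_mul, c, b.coord_apply]
  have hint : ∀ i, Integrable (fun q => c i q * fderiv ℝ ζ q (b i)) μ := fun i =>
    ((hcoord i).continuous.mul <| (hζ.continuous_fderiv one_ne_zero).clm_apply
      continuous_const).integrable_of_hasCompactSupport (hc.fderiv_apply (𝕜 := ℝ) (b i)).mul_left
  have hint' : ∀ i, Integrable (fun q => fderiv ℝ (c i) q (b i) * ζ q) μ := fun i =>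
    ((((hcoord i).continuous_fderiv one_ne_zero).clm_apply continuous_const).mul
      hζ.continuous).integrable_of_hasCompactSupport hc.mul_left
  simp_rw [hdir, hdiv, Finset.sum_mul]
  rw [integral_finsetSum _ fun i _ => hint i, integral_finsetSum _ fun i _ => hint' i,
    ← Finset.sum_neg_distrib]
  exact Finset.sum_congr rfl fun i _ => integral_mul_fderiv_eq_neg_fderiv_mul_of_integrable
    (hint' i) (hint i)
    (((hcoord i).continuous.mul hζ.continuous).integrable_of_hasCompactSupport hc.mul_left)
    (fun q _ => (hcoord i).differentiable one_ne_zero q)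
    (fun q _ => hζ.differentiable one_ne_zero q)

end Divergence

section Mollification

variable {E F : Type*} [NormedAddCommGroup E] [NormedSpace ℝ E] [FiniteDimensional ℝ E]
  [MeasurableSpace E] [BorelSpace E] [NormedAddCommGroup F] [NormedSpace ℝ F] [CompleteSpace F]
  (μ : Measure E) [μ.IsAddHaarMeasure]

open scoped Convolution

lemma norm_normed_convolution_le (φ : ContDiffBump (0 : E)) {g : E → F} (hg : Continuous g)
    {C : ℝ} (hC : ∀ x, ‖g x‖ ≤ C) (q : E) :
    ‖(φ.normed μ ⋆[ContinuousLinearMap.lsmul ℝ ℝ, μ] g) q‖ ≤ 3 * C := by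
  have hdist := φ.dist_normed_convolution_le (μ := μ) (x₀ := q) (ε := C + C)
    hg.aestronglyMeasurable fun x _ => (dist_le_norm_add_norm _ _).trans (add_le_add (hC x) (hC q))
  rw [dist_eq_norm] at hdist
  linarith [hC q,
    norm_le_norm_add_norm_sub' ((φ.normed μ ⋆[ContinuousLinearMap.lsmul ℝ ℝ, μ] g) q) (g q)]

lemma normed_convolution_eq_zero (φ : ContDiffBump (0 : E)) {g : E → F} {s : Set E}
    (hs : ∀ x ∉ s, g x = 0) {q : E} {r : ℝ} (hr : φ.rOut ≤ r)
    (hq : q ∉ Metric.cthickening r s) :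
    (φ.normed μ ⋆[ContinuousLinearMap.lsmul ℝ ℝ, μ] g) q = 0 := by
  have hball : ∀ x ∈ Metric.ball q φ.rOut, g x = 0 := fun x hx => hs x fun hxs =>
    hq (Metric.mem_cthickening_of_dist_le q x r s hxs
      ((dist_comm q x ▸ (Metric.mem_ball.1 hx).le).trans hr))
  have hzero := hball q (Metric.mem_ball_self φ.rOut_pos)
  rw [φ.normed_convolution_eq_right (μ := μ) fun x hx => (hball x hx).trans hzero.symm, hzero]

lemma exists_smooth_approx {ζ : E → ℝ} (hζ : ContDiff ℝ 1 ζ)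
    (hc : HasCompactSupport ζ) (h0 : ∀ q, 0 ≤ ζ q) :
    ∃ (Z : ℕ → E → ℝ) (S : Set E) (C : ℝ), IsCompact S ∧
      (∀ n, ContDiff ℝ ∞ (Z n)) ∧ (∀ n q, 0 ≤ Z n q) ∧
      (∀ n, ∀ q ∉ S, Z n q = 0 ∧ fderiv ℝ (Z n) q = 0) ∧
      (∀ n q, ‖Z n q‖ ≤ C ∧ ‖fderiv ℝ (Z n) q‖ ≤ C) ∧
      (∀ q, Tendsto (fun n => Z n q) atTop (𝓝 (ζ q))) ∧
      ∀ q, Tendsto (fun n => fderiv ℝ (Z n) q) atTop (𝓝 (fderiv ℝ ζ q)) := by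
  have : ProperSpace E := FiniteDimensional.proper_rclike ℝ E
  let μ : Measure E := Measure.addHaar
  have hd : Continuous (fderiv ℝ ζ) := hζ.continuous_fderiv one_ne_zero
  obtain ⟨C₁, hC₁⟩ := hc.exists_bound_of_continuous hζ.continuous
  obtain ⟨C₂, hC₂⟩ := (hc.fderiv (𝕜 := ℝ)).exists_bound_of_continuous hd
  let φ : ℕ → ContDiffBump (0 : E) := fun n =>
    ⟨1 / (n + 1) / 2, 1 / (n + 1), by positivity, half_lt_self (by positivity)⟩
  have hφ : Tendsto (fun n => (φ n).rOut) atTop (𝓝 0) := tendsto_one_div_add_atTop_nhds_zero_nat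
  have hφ1 : ∀ n, (φ n).rOut ≤ 1 := fun n =>
    div_le_one_of_le₀ (by linarith [(n.cast_nonneg : (0 : ℝ) ≤ n)]) (by positivity)
  let Z : ℕ → E → ℝ := fun n => (φ n).normed μ ⋆[ContinuousLinearMap.lsmul ℝ ℝ, μ] ζ
  have hZd : ∀ n q, fderiv ℝ (Z n) q =
      ((φ n).normed μ ⋆[ContinuousLinearMap.lsmul ℝ ℝ, μ] fderiv ℝ ζ) q := fun n q =>
    (hc.hasFDerivAt_convolution_right (ContinuousLinearMap.lsmul ℝ ℝ)
      (φ n).continuous_normed.locallyIntegrable hζ q).fderiv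
  refine ⟨Z, Metric.cthickening 1 (tsupport ζ), max (3 * C₁) (3 * C₂), hc.isCompact.cthickening,
    fun n => (φ n).hasCompactSupport_normed.contDiff_convolution_left _ (φ n).contDiff_normed
      hζ.continuous.locallyIntegrable, fun n q => ?_, fun n q hq => ⟨?_, ?_⟩,
    fun n q => ⟨?_, ?_⟩, fun q => ?_, fun q => ?_⟩
  · exact integral_nonneg fun x => mul_nonneg ((φ n).nonneg_normed x) (h0 _)
  · exact normed_convolution_eq_zero μ (φ n) (fun x hx => image_eq_zero_of_notMem_tsupport hx)
      (hφ1 n) hq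
  · rw [hZd]
    exact normed_convolution_eq_zero μ (φ n) (fun x hx => fderiv_of_notMem_tsupport ℝ hx)
      (hφ1 n) hq
  · exact (norm_normed_convolution_le μ (φ n) hζ.continuous hC₁ q).trans (le_max_left _ _)
  · rw [hZd]
    exact (norm_normed_convolution_le μ (φ n) hd hC₂ q).trans (le_max_right _ _)
  · exact ContDiffBump.convolution_tendsto_right_of_continuous hφ hζ.continuous q
  · simp_rw [hZd]
    exact ContDiffBump.convolution_tendsto_right_of_continuous hφ hd q

end Mollification

section Horizontal

variable {m : ℕ}

instance instIsAddHaarMeasureVolumeHeis (m : ℕ) :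
    (volume : Measure (Heis m)).IsAddHaarMeasure :=
  Measure.prod.instIsAddHaarMeasure _ (Measure.prod volume volume)

/-- The horizontal vector at `q` with coefficients `a` in the frame `X_1, …, X_m, Y_1, …, Y_m`. -/
def frame (q : Heis m) (a : EuclideanSpace ℝ (Fin m ⊕ Fin m)) : Heis m :=
  (fun j => a (Sum.inl j), fun j => a (Sum.inr j),
    2 * ∑ j, (q.2.1 j * a (Sum.inl j) - q.1 j * a (Sum.inr j)))

/-- The restriction of a covector at `q` to the horizontal space, in coordinates: the adjoint of
`frame q`. -/
noncomputable def horiz (q : Heis m) :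
    (Heis m →L[ℝ] ℝ) →ₗ[ℝ] EuclideanSpace ℝ (Fin m ⊕ Fin m) where
  toFun l := WithLp.toLp 2 (Sum.elim (fun j => l (Pi.single j 1, 0, 2 * q.2.1 j))
    (fun j => l (0, Pi.single j 1, -(2 * q.1 j))))
  map_add' l l' := by ext (j | j) <;> simp
  map_smul' c l := by ext (j | j) <;> simp

lemma gradH_eq_horiz (u : Heis m → ℝ) (q : Heis m) : gradH u q = horiz q (fderiv ℝ u q) := rfl

lemma gradH_eq_of_hasFDerivAt {u : Heis m → ℝ} {q : Heis m} {l : Heis m →L[ℝ] ℝ}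
    (h : HasFDerivAt u l q) : gradH u q = horiz q l := by
  rw [gradH_eq_horiz, h.fderiv]

lemma inner_horiz (q : Heis m) (a : EuclideanSpace ℝ (Fin m ⊕ Fin m)) (l : Heis m →L[ℝ] ℝ) :
    inner ℝ a (horiz q l) = l (frame q a) := by
  have hframe : frame q a = ∑ j, (a (Sum.inl j) • (Pi.single j 1, 0, 2 * q.2.1 j) +
      a (Sum.inr j) • (0, Pi.single j 1, -(2 * q.1 j))) := by
    refine Prod.ext ?_ (Prod.ext ?_ ?_)
    · ext i; simp [frame, Prod.fst_sum, Finset.sum_apply, Pi.single_apply]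
    · ext i; simp [frame, Prod.fst_sum, Prod.snd_sum, Finset.sum_apply, Pi.single_apply]
    · simp only [frame, Prod.snd_sum, Finset.mul_sum]
      refine Finset.sum_congr rfl fun j _ => ?_
      simp
      ring
  simp only [hframe, map_sum, map_add, map_smul, smul_eq_mul, Finset.sum_add_distrib]
  simp [horiz, PiLp.inner_apply, mul_comm]

lemma continuous_uncurry_horiz :
    Continuous fun x : Heis m × (Heis m →L[ℝ] ℝ) => horiz x.1 x.2 := by
  refine (PiLp.continuous_toLp 2 _).comp (continuous_pi ?_)
  rintro (j | j) <;> exact continuous_snd.clm_apply (by fun_prop)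

lemma continuous_gradH {u : Heis m → ℝ} (hu : ContDiff ℝ 1 u) : Continuous (gradH u) :=
  continuous_uncurry_horiz.comp (continuous_id.prodMk (hu.continuous_fderiv one_ne_zero))

lemma hasCompactSupport_gradH {u : Heis m → ℝ} (hu : HasCompactSupport u) :
    HasCompactSupport (gradH u) :=
  hu.fderiv (𝕜 := ℝ) |>.mono fun q hq hzero => hq <| by rw [gradH_eq_horiz, hzero, map_zero]

lemma integrable_inner_gradH {A : Heis m → EuclideanSpace ℝ (Fin m ⊕ Fin m)} {ζ : Heis m → ℝ}
    (hA : Continuous A) (hζ : ContDiff ℝ 1 ζ) (hc : HasCompactSupport ζ) :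
    Integrable fun q => inner ℝ (A q) (gradH ζ q) :=
  (hA.inner (continuous_gradH hζ)).integrable_of_hasCompactSupport <|
    (hasCompactSupport_gradH hc).mono fun q hq hzero => hq (by simp only [hzero, inner_zero_right])

end Horizontal

lemma tendsto_integral_inner_of_locallyIntegrable {X V : Type*} [TopologicalSpace X] [T2Space X]
    [MeasurableSpace X] [BorelSpace X] [NormedAddCommGroup V] [InnerProductSpace ℝ V]
    {μ : Measure X} {A : X → V} {B : ℕ → X → V} {b : X → V} {S : Set X} {C : ℝ}
    (hA : LocallyIntegrable A μ) (hAm : AEStronglyMeasurable A μ)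
    (hB : ∀ n, AEStronglyMeasurable (B n) μ) (hS : IsCompact S)
    (hBS : ∀ n, ∀ q ∉ S, B n q = 0) (hBC : ∀ n, ∀ q ∈ S, ‖B n q‖ ≤ C)
    (hlim : ∀ q, Tendsto (fun n => B n q) atTop (𝓝 (b q))) :
    Tendsto (fun n => ∫ q, inner ℝ (B n q) (A q) ∂μ) atTop (𝓝 (∫ q, inner ℝ (b q) (A q) ∂μ)) := by
  refine tendsto_integral_of_dominated_convergence (S.indicator fun q => C * ‖A q‖)
    (fun n => (hB n).inner hAm)
    ((integrable_indicator_iff hS.measurableSet).2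
      ((hA.integrableOn_isCompact hS).norm.const_mul C))
    (fun n => Eventually.of_forall fun q => ?_)
    (Eventually.of_forall fun q => (hlim q).inner tendsto_const_nhds)
  by_cases hq : q ∈ S
  · rw [indicator_of_mem hq]
    exact (norm_inner_le_norm _ _).trans
      (mul_le_mul_of_nonneg_right (hBC n q hq) (norm_nonneg _))
  · rw [indicator_of_notMem hq, hBS n q hq, inner_zero_left, norm_zero]

lemma IsWeakSolution.weak_ineq_of_contDiff_one {m : ℕ} {φ f h g : ℝ → ℝ} {u : Heis m → ℝ}
    (hφ : ContinuousOn φ (Ici 0)) (hφ0 : φ 0 = 0) (hu : IsWeakSolution φ f h g u)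
    {ζ : Heis m → ℝ} (hζ : ContDiff ℝ 1 ζ) (hc : HasCompactSupport ζ) (h0 : ∀ q, 0 ≤ ζ q) :
    ∫ q, (f (u q) - h (u q) * g ‖gradH u q‖) * ζ q ≤
      -∫ q, inner ℝ (flux φ (gradH u q)) (gradH ζ q) := by
  obtain ⟨Z, S, C, hS, hZ, hZ0, hZS, hZC, hZt, hZd⟩ := exists_smooth_approx hζ hc h0
  have hA : Continuous fun q => flux φ (gradH u q) :=
    (continuous_flux hφ hφ0).comp (continuous_gradH hu.contDiff)
  have hlim_rhs : Tendsto (fun n => ∫ q, (f (u q) - h (u q) * g ‖gradH u q‖) * Z n q) atTop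
      (𝓝 (∫ q, (f (u q) - h (u q) * g ‖gradH u q‖) * ζ q)) :=
    tendsto_integral_inner_of_locallyIntegrable hu.locallyIntegrable
      hu.locallyIntegrable.aestronglyMeasurable
      (fun n => (hZ n).continuous.aestronglyMeasurable) hS (fun n q hq => (hZS n q hq).1)
      (fun n q _ => (hZC n q).1) hZt
  obtain ⟨D, hD⟩ : ∃ D, ∀ q ∈ S, ∀ l : Heis m →L[ℝ] ℝ, ‖l‖ ≤ C → ‖horiz q l‖ ≤ D := by
    obtain ⟨D, hD⟩ := (hS.prod (isCompact_closedBall (0 : Heis m →L[ℝ] ℝ) C)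
      ).exists_bound_of_continuousOn continuous_uncurry_horiz.continuousOn
    exact ⟨D, fun q hq l hl => hD (q, l) ⟨hq, mem_closedBall_zero_iff.2 hl⟩⟩
  have hlim_flux : Tendsto (fun n => ∫ q, inner ℝ (gradH (Z n) q) (flux φ (gradH u q))) atTop
      (𝓝 (∫ q, inner ℝ (gradH ζ q) (flux φ (gradH u q)))) :=
    tendsto_integral_inner_of_locallyIntegrable hA.locallyIntegrable hA.aestronglyMeasurable
      (fun n => (continuous_gradH ((hZ n).of_le (by simp))).aestronglyMeasurable) hS
      (fun n q hq => by rw [gradH_eq_horiz, (hZS n q hq).2, map_zero])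
      (fun n q hq => hD q hq _ (hZC n q).2)
      fun q => (continuous_uncurry_horiz.tendsto (q, fderiv ℝ ζ q)).comp
        (tendsto_const_nhds.prodMk_nhds (hZd q))
  simp only [real_inner_comm (flux φ _)] at hlim_flux
  refine le_of_tendsto_of_tendsto' hlim_rhs hlim_flux.neg fun n => ?_
  refine (hu.weak_ineq (Z n) (hZ n)
    (HasCompactSupport.intro hS fun q hq => (hZS n q hq).1) (hZ0 n)).trans_eq ?_
  simp only [flux, real_inner_smul_left]

section Gauge

variable {m : ℕ}

/-- The square `|z|² = |x|² + |y|²` of the horizontal radius. -/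
def zsq (q : Heis m) : ℝ := ∑ j, (q.1 j ^ 2 + q.2.1 j ^ 2)

/-- The fourth power `|z|⁴ + t²` of the Korányi gauge, which is smooth at the origin. -/
def gaugeN (q : Heis m) : ℝ := zsq q ^ 2 + q.2.2 ^ 2

/-- The frame coefficients of the horizontal gradient of `gaugeN`, divided by `4`. -/
noncomputable def gaugeField (q : Heis m) : EuclideanSpace ℝ (Fin m ⊕ Fin m) :=
  WithLp.toLp 2 (Sum.elim (fun j => zsq q * q.1 j + q.2.2 * q.2.1 j)
    (fun j => zsq q * q.2.1 j - q.2.2 * q.1 j))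

lemma zsq_nonneg (q : Heis m) : 0 ≤ zsq q := Finset.sum_nonneg fun _ _ => by positivity

lemma gaugeN_nonneg (q : Heis m) : 0 ≤ gaugeN q := by unfold gaugeN; positivity

lemma sq_zsq_le_gaugeN (q : Heis m) : zsq q ^ 2 ≤ gaugeN q :=
  le_add_of_nonneg_right (sq_nonneg _)

@[fun_prop] lemma contDiff_zsq {n : WithTop ℕ∞} : ContDiff ℝ n (zsq : Heis m → ℝ) := by
  unfold zsq; fun_prop

@[fun_prop] lemma contDiff_gaugeN {n : WithTop ℕ∞} : ContDiff ℝ n (gaugeN : Heis m → ℝ) := by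
  unfold gaugeN; fun_prop

@[fun_prop] lemma continuous_zsq : Continuous (zsq : Heis m → ℝ) :=
  (contDiff_zsq (n := 1)).continuous

@[fun_prop] lemma continuous_gaugeN : Continuous (gaugeN : Heis m → ℝ) :=
  (contDiff_gaugeN (n := 1)).continuous

lemma differentiable_zsq : Differentiable ℝ (zsq : Heis m → ℝ) :=
  (contDiff_zsq (n := 1)).differentiable one_ne_zero

lemma differentiable_gaugeN : Differentiable ℝ (gaugeN : Heis m → ℝ) :=
  (contDiff_gaugeN (n := 1)).differentiable one_ne_zero

lemma isCompact_gaugeN_le (L : ℝ) : IsCompact {q : Heis m | gaugeN q ≤ L} := by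
  refine Metric.isCompact_of_isClosed_isBounded (isClosed_le continuous_gaugeN continuous_const)
    ((Metric.isBounded_closedBall (x := (0 : Heis m)) (r := 1 + L)).subset fun q hq => ?_)
  have hN : zsq q ^ 2 + q.2.2 ^ 2 ≤ L := hq
  have hL : 0 ≤ L := (gaugeN_nonneg q).trans hN
  have hz : zsq q ≤ 1 + L := by nlinarith [sq_nonneg q.2.2, sq_nonneg (zsq q - 1)]
  have hj : ∀ j, q.1 j ^ 2 + q.2.1 j ^ 2 ≤ zsq q := fun j =>
    Finset.single_le_sum (f := fun j => q.1 j ^ 2 + q.2.1 j ^ 2)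
      (fun _ _ => by positivity) (Finset.mem_univ j)
  have habs : ∀ s : ℝ, s ^ 2 ≤ 1 + L → |s| ≤ 1 + L := fun s hs =>
    abs_le_of_sq_le_sq (by nlinarith) (by linarith)
  rw [mem_closedBall_zero_iff, Prod.norm_def, Prod.norm_def]
  refine max_le ((pi_norm_le_iff_of_nonneg (by linarith)).2 fun j => ?_)
    (max_le ((pi_norm_le_iff_of_nonneg (by linarith)).2 fun j => ?_) ?_)
  · exact habs _ (by nlinarith [hj j, sq_nonneg (q.2.1 j)])
  · exact habs _ (by nlinarith [hj j, sq_nonneg (q.1 j)])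
  · exact habs _ (by nlinarith [sq_nonneg (zsq q)])

/-- The coordinate `x_j` as a linear form. -/
def coordX (j : Fin m) : Heis m →L[ℝ] ℝ :=
  ContinuousLinearMap.proj j ∘L ContinuousLinearMap.fst ℝ _ _

/-- The coordinate `y_j` as a linear form. -/
def coordY (j : Fin m) : Heis m →L[ℝ] ℝ :=
  ContinuousLinearMap.proj j ∘L ContinuousLinearMap.fst ℝ _ _ ∘L ContinuousLinearMap.snd ℝ _ _

/-- The coordinate `t` as a linear form. -/
def coordT : Heis m →L[ℝ] ℝ := ContinuousLinearMap.snd ℝ _ _ ∘L ContinuousLinearMap.snd ℝ _ _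

@[simp] lemma coordX_apply (j : Fin m) (q : Heis m) : coordX j q = q.1 j := rfl

@[simp] lemma coordY_apply (j : Fin m) (q : Heis m) : coordY j q = q.2.1 j := rfl

@[simp] lemma coordT_apply (q : Heis m) : coordT q = q.2.2 := rfl

lemma fderiv_zsq (q v : Heis m) :
    fderiv ℝ zsq q v = ∑ j, (2 * q.1 j * v.1 j + 2 * q.2.1 j * v.2.1 j) := by
  have h : HasFDerivAt (zsq : Heis m → ℝ) _ q := HasFDerivAt.fun_sum fun j _ =>
    ((coordX j).hasFDerivAt.pow 2).add ((coordY j).hasFDerivAt.pow 2)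
  rw [h.fderiv]
  simp

lemma fderiv_gaugeN (q v : Heis m) :
    fderiv ℝ gaugeN q v = 2 * zsq q * fderiv ℝ zsq q v + 2 * q.2.2 * v.2.2 := by
  have h : HasFDerivAt gaugeN _ q :=
    ((differentiable_zsq q).hasFDerivAt.pow 2).add (coordT.hasFDerivAt.pow 2)
  rw [h.fderiv]
  simp

lemma gradH_gaugeN (q : Heis m) : gradH gaugeN q = (4 : ℝ) • gaugeField q := by
  ext (j | j) <;>
    simp [gradH, fieldX, fieldY, gaugeField, fderiv_gaugeN, fderiv_zsq, Pi.single_apply] <;> ring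

lemma norm_gaugeField_sq (q : Heis m) : ‖gaugeField q‖ ^ 2 = zsq q * gaugeN q := by
  rw [EuclideanSpace.norm_sq_eq, Fintype.sum_sum_type, ← Finset.sum_add_distrib]
  simp only [gaugeField, Sum.elim_inl, Sum.elim_inr, Real.norm_eq_abs, sq_abs]
  conv_rhs => rw [zsq, Finset.sum_mul]
  exact Finset.sum_congr rfl fun j _ => by rw [gaugeN]; ring

lemma norm_gaugeField (q : Heis m) : ‖gaugeField q‖ = √(zsq q) * √(gaugeN q) := by
  rw [← Real.sqrt_mul (zsq_nonneg q), ← norm_gaugeField_sq, Real.sqrt_sq (norm_nonneg _)]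

/-- The Euclidean vector field underlying `gaugeField`. -/
noncomputable def gaugeVec (q : Heis m) : Heis m := frame q (gaugeField q)

lemma gaugeVec_eq (q : Heis m) :
    gaugeVec q = zsq q • (q.1, q.2.1, 2 * q.2.2) + q.2.2 • (q.2.1, -q.1, 0) := by
  refine Prod.ext ?_ (Prod.ext ?_ ?_)
  · ext j; simp [gaugeVec, frame, gaugeField]
  · ext j; simp [gaugeVec, frame, gaugeField, sub_eq_add_neg]
  · have h : ∀ j, q.2.1 j * (zsq q * q.1 j + q.2.2 * q.2.1 j) -
        q.1 j * (zsq q * q.2.1 j - q.2.2 * q.1 j) = q.2.2 * (q.1 j ^ 2 + q.2.1 j ^ 2) :=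
      fun j => by ring
    simp only [gaugeVec, frame, gaugeField, Sum.elim_inl, Sum.elim_inr, h]
    rw [← Finset.mul_sum, ← zsq.eq_def]
    simp
    ring

lemma inner_gaugeField_gradH (q : Heis m) (ζ : Heis m → ℝ) :
    inner ℝ (gaugeField q) (gradH ζ q) = fderiv ℝ ζ q (gaugeVec q) := inner_horiz _ _ _

lemma contDiff_gaugeVec {n : WithTop ℕ∞} : ContDiff ℝ n (gaugeVec : Heis m → Heis m) := by
  rw [funext gaugeVec_eq]
  fun_prop

lemma fderiv_zsq_gaugeVec (q : Heis m) : fderiv ℝ zsq q (gaugeVec q) = 2 * zsq q ^ 2 := by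
  have h : 2 * zsq q ^ 2 = ∑ j, 2 * zsq q * (q.1 j ^ 2 + q.2.1 j ^ 2) := by
    rw [← Finset.mul_sum, ← zsq.eq_def]; ring
  rw [fderiv_zsq, h]
  refine Finset.sum_congr rfl fun j _ => ?_
  simp [gaugeVec_eq]
  ring

lemma fderiv_gaugeN_gaugeVec (q : Heis m) :
    fderiv ℝ gaugeN q (gaugeVec q) = 4 * zsq q * gaugeN q := by
  rw [fderiv_gaugeN, fderiv_zsq_gaugeVec, gaugeN]
  simp [gaugeVec_eq]
  ring

lemma divergence_heis (W : Heis m → Heis m) (q : Heis m) :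
    divergence W q = ∑ j, ((fderiv ℝ W q (Pi.single j 1, 0, 0)).1 j +
      (fderiv ℝ W q (0, Pi.single j 1, 0)).2.1 j) + (fderiv ℝ W q (0, 0, 1)).2.2 := by
  rw [divergence_eq_sum ((Pi.basisFun ℝ (Fin m)).prod
    ((Pi.basisFun ℝ (Fin m)).prod (Module.Basis.singleton Unit ℝ)))]
  simp only [Fintype.sum_sum_type, Finset.univ_unique, Finset.sum_singleton,
    Module.Basis.coord_apply, Module.Basis.prod_repr_inl, Module.Basis.prod_repr_inr,
    Finset.sum_add_distrib, add_assoc]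
  simp [Prod.zero_eq_mk]

lemma divergence_gaugeVec (q : Heis m) : divergence gaugeVec q = (2 * m + 4) * zsq q := by
  let A : Heis m →L[ℝ] Heis m :=
    (ContinuousLinearMap.fst ℝ _ _).prod (((ContinuousLinearMap.fst ℝ _ _).comp
      (ContinuousLinearMap.snd ℝ _ _)).prod ((2 : ℝ) • (ContinuousLinearMap.snd ℝ _ _).comp
        (ContinuousLinearMap.snd ℝ _ _)))
  let J : Heis m →L[ℝ] Heis m :=
    ((ContinuousLinearMap.fst ℝ _ _).comp (ContinuousLinearMap.snd ℝ _ _)).prod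
      ((-ContinuousLinearMap.fst ℝ _ _).prod 0)
  have hA : divergence A q = 2 * m + 2 := by
    rw [divergence_heis, A.fderiv]
    simp [A]
    ring
  have hJ : divergence J q = 0 := by
    rw [divergence_heis, J.fderiv]
    simp [J]
  have hzA : fderiv ℝ zsq q (A q) = 2 * zsq q := by
    rw [fderiv_zsq, zsq, Finset.mul_sum]
    exact Finset.sum_congr rfl fun j _ => by
      simp only [A, ContinuousLinearMap.prod_apply, ContinuousLinearMap.comp_apply,
        ContinuousLinearMap.coe_fst', ContinuousLinearMap.coe_snd']
      ring
  have hvec : gaugeVec = fun q => zsq q • A q + coordT q • J q := funext gaugeVec_eq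
  rw [hvec, divergence_add ((differentiable_zsq q).fun_smul A.differentiableAt)
    (coordT.differentiableAt.fun_smul J.differentiableAt), divergence_smul (differentiable_zsq q)
    A.differentiableAt, divergence_smul coordT.differentiableAt J.differentiableAt, hA, hJ, hzA,
    coordT.fderiv]
  simp [J]
  ring

end Gauge

section Barrier

variable {m : ℕ} {p μ d : ℝ}

/-- The coefficient of `gaugeField` in the flux of a power of the gauge. The parameter `d > 0`
removes the singularity on the axis `z = 0`; the true flux has `d = 0`. -/
noncomputable def fluxCoeff (p μ d : ℝ) (q : Heis m) : ℝ :=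
  gaugeN q ^ μ * (zsq q + d) ^ ((p - 2) / 2)

lemma contDiff_const_add_gaugeN_rpow {lam : ℝ} (hlam : 1 ≤ lam) (b c : ℝ) :
    ContDiff ℝ 1 fun q : Heis m => b + c * gaugeN q ^ lam :=
  contDiff_const.add <| contDiff_const.mul <|
    (Real.contDiff_rpow_const_of_le (n := 1) (by simpa using hlam)).comp contDiff_gaugeN

lemma gradH_const_add_gaugeN_rpow {lam : ℝ} (hlam : 1 ≤ lam) (b c : ℝ) (q : Heis m) :
    gradH (fun q => b + c * gaugeN q ^ lam) q =
      (4 * c * lam * gaugeN q ^ (lam - 1)) • gaugeField q := by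
  have h := (((Real.hasDerivAt_rpow_const (Or.inr hlam)).comp_hasFDerivAt q
    (differentiable_gaugeN q).hasFDerivAt).const_mul c).const_add b
  have hgrad := gradH_eq_of_hasFDerivAt h
  rw [map_smul, map_smul, ← gradH_eq_horiz, gradH_gaugeN, smul_smul, smul_smul] at hgrad
  refine hgrad.trans ?_
  congr 1
  ring

lemma flux_gradH_const_add_gaugeN_rpow {lam : ℝ} (hlam : 1 ≤ lam)
    (b : ℝ) {c : ℝ} (hc : 0 < c) (q : Heis m) :
    flux (phiP p) (gradH (fun q => b + c * gaugeN q ^ lam) q) = ((4 * c * lam) ^ (p - 1) *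
      fluxCoeff p ((lam - 1 / 2) * (p - 1) - 1 / 2) 0 q) • gaugeField q := by
  rw [gradH_const_add_gaugeN_rpow hlam]
  rcases eq_or_ne (gaugeField q) 0 with h0 | h0
  · simp [h0]
  have hprod : 0 < zsq q * gaugeN q := by
    rw [← norm_gaugeField_sq]
    exact pow_pos (norm_pos_iff.2 h0) 2
  have hN : 0 < gaugeN q := pos_of_mul_pos_right hprod (zsq_nonneg q)
  have hexp : gaugeN q ^ ((lam - 1 / 2) * (p - 1) - 1 / 2) =
      gaugeN q ^ ((lam - 1) * (p - 1)) * gaugeN q ^ (1 / 2 * (p - 2)) := by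
    rw [← Real.rpow_add hN]
    ring_nf
  rw [flux_phiP_smul _ (by positivity), flux_phiP_eq_smul, smul_smul, norm_gaugeField,
    Real.mul_rpow (x := 4 * c * lam) (by positivity) (by positivity),
    Real.mul_rpow (x := √(zsq q)) (by positivity) (by positivity), Real.sqrt_eq_rpow,
    Real.sqrt_eq_rpow, ← Real.rpow_mul (zsq_nonneg q), ← Real.rpow_mul hN.le,
    ← Real.rpow_mul hN.le, fluxCoeff, hexp, add_zero, show (p - 2) / 2 = 1 / 2 * (p - 2) by ring]
  ring_nf

lemma contDiff_fluxCoeff (p : ℝ) (hμ : 1 ≤ μ) (hd : 0 < d) :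
    ContDiff ℝ 1 (fluxCoeff (m := m) p μ d) :=
  ((Real.contDiff_rpow_const_of_le (n := 1) (by simpa using hμ)).comp contDiff_gaugeN).mul <|
    (contDiff_zsq.add contDiff_const).rpow_const_of_ne fun q =>
      (add_pos_of_nonneg_of_pos (zsq_nonneg q) hd).ne'

lemma fderiv_fluxCoeff_gaugeVec (p : ℝ) (hμ : 1 ≤ μ) (hd : 0 < d) (q : Heis m) :
    fderiv ℝ (fluxCoeff p μ d) q (gaugeVec q) =
      fluxCoeff p μ d q * zsq q * (4 * μ + (p - 2) * (zsq q / (zsq q + d))) := by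
  have hpos : 0 < zsq q + d := add_pos_of_nonneg_of_pos (zsq_nonneg q) hd
  have hN : HasFDerivAt (fun q : Heis m => gaugeN q ^ μ) _ q :=
    (Real.hasDerivAt_rpow_const (Or.inr hμ)).comp_hasFDerivAt q
      (differentiable_gaugeN q).hasFDerivAt
  have hz : HasFDerivAt (fun q : Heis m => (zsq q + d) ^ ((p - 2) / 2)) _ q :=
    ((differentiable_zsq q).hasFDerivAt.add_const d).rpow_const (Or.inl hpos.ne')
  have hNμ : gaugeN q ^ (μ - 1) * gaugeN q = gaugeN q ^ μ := by
    rcases (gaugeN_nonneg q).eq_or_lt with h | h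
    · rw [← h, Real.zero_rpow (by linarith : μ ≠ 0), mul_zero]
    · rw [← Real.rpow_add_one h.ne', sub_add_cancel]
  rw [HasFDerivAt.fderiv (f := fluxCoeff p μ d) (hN.mul hz), fluxCoeff]
  simp only [add_apply, smul_apply, smul_eq_mul, fderiv_zsq_gaugeVec, fderiv_gaugeN_gaugeVec]
  rw [Real.rpow_sub_one hpos.ne', ← hNμ]
  field_simp
  ring

lemma divergence_fluxCoeff_smul_gaugeVec_le (hp : 0 ≤ p) (hμ : 1 ≤ μ) (hd : 0 < d) (q : Heis m) :
    divergence (fun q => fluxCoeff p μ d q • gaugeVec q) q ≤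
      (4 * μ + 2 * m + 4 + p) * (gaugeN q ^ μ * (zsq q + d) ^ (p / 2)) := by
  have hz := zsq_nonneg q
  have hpos : 0 < zsq q + d := by positivity
  have hN : 0 ≤ gaugeN q ^ μ := Real.rpow_nonneg (gaugeN_nonneg q) _
  have hcoeff : 0 ≤ fluxCoeff p μ d q := by unfold fluxCoeff; positivity
  have hratio : (p - 2) * (zsq q / (zsq q + d)) ≤ p := by
    have h0 : 0 ≤ zsq q / (zsq q + d) := by positivity
    have h1 : zsq q / (zsq q + d) ≤ 1 := (div_le_one hpos).2 (by linarith)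
    nlinarith
  rw [divergence_smul ((contDiff_fluxCoeff p hμ hd).differentiable one_ne_zero q)
    ((contDiff_gaugeVec (n := 1)).differentiable one_ne_zero q), divergence_gaugeVec,
    fderiv_fluxCoeff_gaugeVec p hμ hd]
  calc _ = fluxCoeff p μ d q * zsq q *
        (4 * μ + 2 * m + 4 + (p - 2) * (zsq q / (zsq q + d))) := by ring
    _ ≤ fluxCoeff p μ d q * zsq q * (4 * μ + 2 * m + 4 + p) := by gcongr
    _ ≤ fluxCoeff p μ d q * (zsq q + d) * (4 * μ + 2 * m + 4 + p) := by
      gcongr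
      linarith
    _ = _ := by
      rw [fluxCoeff, mul_assoc (gaugeN q ^ μ), ← Real.rpow_add_one hpos.ne',
        show (p - 2) / 2 + 1 = p / 2 by ring]
      ring

lemma neg_integral_fluxCoeff_mul_inner_le (hp : 0 ≤ p) (hμ : 1 ≤ μ) (hd : 0 < d) {L : ℝ}
    {ζ : Heis m → ℝ} (hζ : ContDiff ℝ 1 ζ) (hc : HasCompactSupport ζ) (h0 : ∀ q, 0 ≤ ζ q)
    (hζL : ∀ q, L < gaugeN q → ζ q = 0) :
    -∫ q, fluxCoeff p μ d q * inner ℝ (gaugeField q) (gradH ζ q) ≤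
      (4 * μ + 2 * m + 4 + p) * (L ^ μ * (√L + d) ^ (p / 2)) * ∫ q, ζ q := by
  have hW : ContDiff ℝ 1 fun q : Heis m => fluxCoeff p μ d q • gaugeVec q :=
    (contDiff_fluxCoeff p hμ hd).smul contDiff_gaugeVec
  have hparts := integral_fderiv_apply_eq_neg_integral_divergence_mul volume hW hζ hc
  simp only [map_smul, smul_eq_mul] at hparts
  simp only [inner_gaugeField_gradH]
  rw [hparts, neg_neg, ← integral_const_mul]
  refine integral_mono
    (((continuous_divergence hW).mul hζ.continuous).integrable_of_hasCompactSupport hc.mul_left)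
    ((hζ.continuous.integrable_of_hasCompactSupport hc).const_mul _) fun q => ?_
  rcases lt_or_ge L (gaugeN q) with h | h
  · simp [hζL q h]
  · refine mul_le_mul_of_nonneg_right
      ((divergence_fluxCoeff_smul_gaugeVec_le hp hμ hd q).trans ?_) (h0 q)
    have hz : zsq q ≤ √L := Real.le_sqrt_of_sq_le ((sq_zsq_le_gaugeN q).trans h)
    have hz0 := zsq_nonneg q
    have hN0 := gaugeN_nonneg q
    have hL : 0 ≤ L ^ μ := Real.rpow_nonneg (hN0.trans h) μ
    gcongr

lemma norm_fluxCoeff_smul_gaugeField_le (hp : 1 ≤ p) (hd : d ∈ Ioc (0 : ℝ) 1) (q : Heis m) :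
    ‖fluxCoeff p μ d q • gaugeField q‖ ≤
      gaugeN q ^ μ * (zsq q + 1) ^ ((p - 1) / 2) * √(gaugeN q) := by
  have hz := zsq_nonneg q
  have hN : 0 ≤ gaugeN q ^ μ := Real.rpow_nonneg (gaugeN_nonneg q) _
  have hpos : 0 < zsq q + d := add_pos_of_nonneg_of_pos hz hd.1
  have hsqrt : (zsq q + d) ^ ((p - 2) / 2) * √(zsq q) ≤ (zsq q + 1) ^ ((p - 1) / 2) :=
    calc _ ≤ (zsq q + d) ^ ((p - 2) / 2) * √(zsq q + d) := by
          gcongr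
          linarith [hd.1]
      _ = (zsq q + d) ^ ((p - 1) / 2) := by
          rw [Real.sqrt_eq_rpow, ← Real.rpow_add hpos]
          ring_nf
      _ ≤ _ := Real.rpow_le_rpow hpos.le (by linarith [hd.2]) (by linarith)
  rw [norm_smul, fluxCoeff, Real.norm_of_nonneg (by positivity), norm_gaugeField]
  calc _ = gaugeN q ^ μ * ((zsq q + d) ^ ((p - 2) / 2) * √(zsq q)) * √(gaugeN q) := by ring
    _ ≤ _ := by gcongr

lemma tendsto_fluxCoeff_smul_gaugeField (p μ : ℝ) (q : Heis m) :
    Tendsto (fun d => fluxCoeff p μ d q • gaugeField q) (𝓝 0)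
      (𝓝 (fluxCoeff p μ 0 q • gaugeField q)) := by
  rcases eq_or_ne (gaugeField q) 0 with h | h
  · simp [h]
  · have hz : zsq q + 0 ≠ 0 := fun hz => h <| by
      rw [← norm_eq_zero, norm_gaugeField, ← add_zero (zsq q), hz, Real.sqrt_zero, zero_mul]
    exact (Tendsto.const_mul _ ((continuous_const.add continuous_id).continuousAt.rpow_const
      (Or.inl hz)).tendsto).smul_const _

lemma tendsto_integral_fluxCoeff_mul_inner (hp : 1 ≤ p) (hμ : 1 ≤ μ) {ζ : Heis m → ℝ}
    (hζ : ContDiff ℝ 1 ζ) (hc : HasCompactSupport ζ) :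
    Tendsto (fun d => ∫ q, fluxCoeff p μ d q * inner ℝ (gaugeField q) (gradH ζ q)) (𝓝[>] 0)
      (𝓝 (∫ q, fluxCoeff p μ 0 q * inner ℝ (gaugeField q) (gradH ζ q))) := by
  simp only [← real_inner_smul_left]
  refine tendsto_integral_filter_of_dominated_convergence
    (fun q => gaugeN q ^ μ * (zsq q + 1) ^ ((p - 1) / 2) * √(gaugeN q) * ‖gradH ζ q‖) ?_ ?_ ?_
    (Eventually.of_forall fun q => ((tendsto_fluxCoeff_smul_gaugeField p μ q).mono_left
      nhdsWithin_le_nhds).inner tendsto_const_nhds)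
  · filter_upwards [self_mem_nhdsWithin] with d hd
    simp only [real_inner_smul_left, inner_gaugeField_gradH]
    exact ((contDiff_fluxCoeff p hμ hd).continuous.mul ((hζ.continuous_fderiv
      one_ne_zero).clm_apply (contDiff_gaugeVec (n := 1)).continuous)).aestronglyMeasurable
  · filter_upwards [Ioc_mem_nhdsGT (zero_lt_one' ℝ)] with d hd
    exact Eventually.of_forall fun q => (norm_inner_le_norm _ _).trans
      (mul_le_mul_of_nonneg_right (norm_fluxCoeff_smul_gaugeField_le hp hd q) (norm_nonneg _))
  · exact (((continuous_gaugeN.rpow_const fun _ => Or.inr (by linarith)).mul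
      ((continuous_zsq.add continuous_const).rpow_const fun _ => Or.inr (by linarith))).mul
        continuous_gaugeN.sqrt).mul (continuous_gradH hζ).norm
          |>.integrable_of_hasCompactSupport (hasCompactSupport_gradH hc).norm.mul_left

lemma neg_integral_inner_flux_gradH_gaugeN_rpow_le (hp : 1 ≤ p) {lam L : ℝ} (hlam : 1 ≤ lam)
    (hμ : 1 ≤ (lam - 1 / 2) * (p - 1) - 1 / 2) (b : ℝ) {c : ℝ} (hc : 0 < c) (hL : 0 < L)
    {ζ : Heis m → ℝ} (hζ : ContDiff ℝ 1 ζ) (hcs : HasCompactSupport ζ) (h0 : ∀ q, 0 ≤ ζ q)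
    (hζL : ∀ q, L < gaugeN q → ζ q = 0) :
    -∫ q, inner ℝ (flux (phiP p) (gradH (fun q => b + c * gaugeN q ^ lam) q)) (gradH ζ q) ≤
      (4 * c * lam) ^ (p - 1) * ((4 * p + 2 * m) * lam * L ^ (lam * (p - 1) - p / 4)) *
        ∫ q, ζ q := by
  set μ := (lam - 1 / 2) * (p - 1) - 1 / 2 with hμ_def
  have hbound : Continuous fun d : ℝ =>
      (4 * μ + 2 * m + 4 + p) * (L ^ μ * (√L + d) ^ (p / 2)) * ∫ q, ζ q := by
    have : Continuous fun d : ℝ => (√L + d) ^ (p / 2) :=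
      (continuous_const.add continuous_id).rpow_const fun _ => Or.inr (by linarith)
    fun_prop
  have hle : -∫ q, fluxCoeff p μ 0 q * inner ℝ (gaugeField q) (gradH ζ q) ≤
      (4 * μ + 2 * m + 4 + p) * (L ^ μ * (√L + 0) ^ (p / 2)) * ∫ q, ζ q :=
    le_of_tendsto_of_tendsto (tendsto_integral_fluxCoeff_mul_inner hp hμ hζ hcs).neg
      ((hbound.tendsto 0).mono_left nhdsWithin_le_nhds) <| by
      filter_upwards [self_mem_nhdsWithin] with d hd
      exact neg_integral_fluxCoeff_mul_inner_le (by linarith) hμ hd hζ hcs h0 hζL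
  have hpow : L ^ μ * (√L + 0) ^ (p / 2) = L ^ (lam * (p - 1) - p / 4) := by
    rw [add_zero, Real.sqrt_eq_rpow, ← Real.rpow_mul hL.le, ← Real.rpow_add hL, hμ_def]
    ring_nf
  have hconst : 4 * μ + 2 * m + 4 + p ≤ (4 * p + 2 * m) * lam := by
    nlinarith [mul_le_mul_of_nonneg_left hlam (Nat.cast_nonneg (α := ℝ) m)]
  simp only [flux_gradH_const_add_gaugeN_rpow hlam b hc, mul_smul, real_inner_smul_left]
  rw [integral_const_mul, ← mul_neg, mul_assoc (_ ^ (p - 1))]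
  have hζ0 : 0 ≤ ∫ q, ζ q := integral_nonneg h0
  refine mul_le_mul_of_nonneg_left (hle.trans ?_) (by positivity)
  rw [hpow]
  gcongr

end Barrier

section Excess

/-- A smooth substitute for the positive part of `v - w` on `Ω`: it vanishes off `Ω` and where
`v ≤ w`, and it is as regular as `v` and `w` if `v < w` on the frontier of `Ω`. -/
noncomputable def excess {X : Type*} (Ω : Set X) (v w : X → ℝ) : X → ℝ :=
  Ω.indicator fun q => expNegInvGlue (v q - w q)

section Topological

variable {X : Type*} {Ω : Set X} {v w : X → ℝ}

lemma excess_nonneg (Ω : Set X) (v w : X → ℝ) (q : X) : 0 ≤ excess Ω v w q :=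
  indicator_nonneg (fun _ _ => expNegInvGlue.nonneg _) q

lemma excess_eq_zero_of_notMem {q : X} (hq : q ∉ Ω) : excess Ω v w q = 0 :=
  indicator_of_notMem hq _

lemma excess_eq_zero_of_le {q : X} (h : v q ≤ w q) : excess Ω v w q = 0 := by
  simp [excess, indicator_apply_eq_zero, expNegInvGlue.zero_of_nonpos (sub_nonpos.2 h)]

lemma le_of_excess_eq_zero {q : X} (hq : q ∈ Ω) (h : excess Ω v w q = 0) : v q ≤ w q := by
  rwa [excess, indicator_of_mem hq, expNegInvGlue.zero_iff_nonpos, sub_nonpos] at h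

variable [TopologicalSpace X]

lemma excess_eventuallyEq (hΩ : IsOpen Ω) {q : X} (hq : q ∈ Ω) :
    excess Ω v w =ᶠ[𝓝 q] fun x => expNegInvGlue (v x - w x) := by
  filter_upwards [hΩ.mem_nhds hq] with x hx using indicator_of_mem hx _

lemma excess_eventuallyEq_zero_of_lt (hv : Continuous v) (hw : Continuous w) {q : X}
    (h : v q < w q) : excess Ω v w =ᶠ[𝓝 q] 0 := by
  filter_upwards [hv.continuousAt.eventually_lt hw.continuousAt h] with x hx
    using excess_eq_zero_of_le hx.le

lemma excess_eventuallyEq_zero_of_notMem (hΩ : IsOpen Ω) (hv : Continuous v) (hw : Continuous w)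
    (hvw : ∀ q ∈ frontier Ω, v q < w q) {q : X} (hq : q ∉ Ω) : excess Ω v w =ᶠ[𝓝 q] 0 := by
  by_cases hcl : q ∈ closure Ω
  · exact excess_eventuallyEq_zero_of_lt hv hw (hvw q (hΩ.frontier_eq ▸ ⟨hcl, hq⟩))
  · filter_upwards [isClosed_closure.isOpen_compl.mem_nhds hcl] with x hx
      using excess_eq_zero_of_notMem fun h => hx (subset_closure h)

lemma hasCompactSupport_excess [R1Space X] (hΩ : IsCompact (closure Ω)) :
    HasCompactSupport (excess Ω v w) :=
  hΩ.of_isClosed_subset isClosed_closure (closure_mono support_indicator_subset)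

lemma tsupport_excess_subset (hv : Continuous v) (hw : Continuous w) :
    tsupport (excess Ω v w) ⊆ {q | w q ≤ v q} :=
  closure_minimal (fun _ hq => not_lt.1 fun h => hq (excess_eq_zero_of_le h.le))
    (isClosed_le hw hv)

end Topological

variable {E : Type*} [NormedAddCommGroup E] [NormedSpace ℝ E] {Ω : Set E} {v w : E → ℝ}

lemma contDiff_excess (hΩ : IsOpen Ω) (hv : ContDiff ℝ 1 v) (hw : ContDiff ℝ 1 w)
    (hvw : ∀ q ∈ frontier Ω, v q < w q) : ContDiff ℝ 1 (excess Ω v w) := by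
  refine contDiff_iff_contDiffAt.2 fun q => ?_
  by_cases hq : q ∈ Ω
  · exact ((expNegInvGlue.contDiff (n := 1)).comp (hv.sub hw)).contDiffAt.congr_of_eventuallyEq
      (excess_eventuallyEq hΩ hq)
  · exact contDiffAt_const.congr_of_eventuallyEq
      (excess_eventuallyEq_zero_of_notMem hΩ hv.continuous hw.continuous hvw hq)

lemma exists_fderiv_excess_eq_smul (hΩ : IsOpen Ω) (hv : ContDiff ℝ 1 v) (hw : ContDiff ℝ 1 w)
    (hvw : ∀ q ∈ frontier Ω, v q < w q) (q : E) :
    ∃ s : ℝ, 0 ≤ s ∧ fderiv ℝ (excess Ω v w) q = s • (fderiv ℝ v q - fderiv ℝ w q) := by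
  by_cases hq : q ∈ Ω
  · have hderiv : HasFDerivAt (fun x => expNegInvGlue (v x - w x))
        (deriv expNegInvGlue (v q - w q) • (fderiv ℝ v q - fderiv ℝ w q)) q :=
      ((expNegInvGlue.contDiff (n := 1)).differentiable one_ne_zero _).hasDerivAt.comp_hasFDerivAt
        q ((hv.differentiable one_ne_zero q).hasFDerivAt.sub
          (hw.differentiable one_ne_zero q).hasFDerivAt)
    exact ⟨_, expNegInvGlue.monotone.deriv_nonneg,
      (hderiv.congr_of_eventuallyEq (excess_eventuallyEq hΩ hq)).fderiv⟩
  · refine ⟨0, le_rfl, ?_⟩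
    rw [(excess_eventuallyEq_zero_of_notMem hΩ hv.continuous hw.continuous hvw hq).fderiv_eq]
    simp

end Excess

section Comparison

variable {m : ℕ} {φ F : ℝ → ℝ} {v w : Heis m → ℝ}

/-- `v` is a non-negative `C^1` function satisfying `Δ^φ v ≥ F(v)` weakly on the open set
`{v > 0}`. -/
structure IsPosSubsolution (φ F : ℝ → ℝ) (v : Heis m → ℝ) : Prop where
  contDiff : ContDiff ℝ 1 v
  nonneg : ∀ q, 0 ≤ v q
  weak_ineq : ∀ ζ : Heis m → ℝ, ContDiff ℝ 1 ζ → HasCompactSupport ζ → (∀ q, 0 ≤ ζ q) →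
    tsupport ζ ⊆ {q | 0 < v q} →
    ∫ q, F (v q) * ζ q ≤ -∫ q, inner ℝ (flux φ (gradH v q)) (gradH ζ q)

lemma integral_inner_flux_gradH_excess_le (hφ : ContinuousOn φ (Ici 0))
    (hφm : MonotoneOn φ (Ici 0)) (hφ0 : φ 0 = 0) (hv : ContDiff ℝ 1 v) (hw : ContDiff ℝ 1 w)
    {Ω : Set (Heis m)} (hΩ : IsOpen Ω) (hΩc : IsCompact (closure Ω))
    (hvw : ∀ q ∈ frontier Ω, v q < w q) :
    ∫ q, inner ℝ (flux φ (gradH w q)) (gradH (excess Ω v w) q) ≤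
      ∫ q, inner ℝ (flux φ (gradH v q)) (gradH (excess Ω v w) q) := by
  have hflux {u : Heis m → ℝ} (hu : ContDiff ℝ 1 u) : Continuous fun q => flux φ (gradH u q) :=
    (continuous_flux hφ hφ0).comp (continuous_gradH hu)
  have hζ := contDiff_excess hΩ hv hw hvw
  have hζc := hasCompactSupport_excess (v := v) (w := w) hΩc
  refine integral_mono (integrable_inner_gradH (hflux hw) hζ hζc)
    (integrable_inner_gradH (hflux hv) hζ hζc) fun q => ?_
  obtain ⟨s, hs, hgrad⟩ := exists_fderiv_excess_eq_smul hΩ hv hw hvw q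
  have hmono := inner_flux_sub_nonneg hφm hφ0.ge (gradH v q) (gradH w q)
  rw [inner_sub_left] at hmono
  simp only [gradH_eq_horiz (excess Ω v w), hgrad, map_smul, map_sub, ← gradH_eq_horiz,
    real_inner_smul_right]
  exact mul_le_mul_of_nonneg_left (sub_nonneg.1 hmono) hs

theorem IsPosSubsolution.le_of_forall_frontier_lt (hφ : ContinuousOn φ (Ici 0))
    (hφm : MonotoneOn φ (Ici 0)) (hφ0 : φ 0 = 0) (hFc : ContinuousOn F (Ici 0))
    (hFm : MonotoneOn F (Ici 0)) (hv : IsPosSubsolution φ F v) (hw : ContDiff ℝ 1 w)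
    {b κ : ℝ} (hb : 0 < b) (hwb : ∀ q, b ≤ w q) (hκ : κ < F b)
    {Ω : Set (Heis m)} (hΩ : IsOpen Ω) (hΩc : IsCompact (closure Ω))
    (hvw : ∀ q ∈ frontier Ω, v q < w q)
    (hw_super : ∀ ζ : Heis m → ℝ, ContDiff ℝ 1 ζ → HasCompactSupport ζ → (∀ q, 0 ≤ ζ q) →
      (∀ q ∉ Ω, ζ q = 0) → -∫ q, inner ℝ (flux φ (gradH w q)) (gradH ζ q) ≤ κ * ∫ q, ζ q)
    {q : Heis m} (hq : q ∈ Ω) : v q ≤ w q := by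
  set ζ := excess Ω v w
  have hζ : ContDiff ℝ 1 ζ := contDiff_excess hΩ hv.contDiff hw hvw
  have hζc : HasCompactSupport ζ := hasCompactSupport_excess hΩc
  have hζ0 : ∀ q, 0 ≤ ζ q := excess_nonneg Ω v w
  have hζi : Integrable ζ := hζ.continuous.integrable_of_hasCompactSupport hζc
  have hζv : tsupport ζ ⊆ {q | 0 < v q} := fun x hx => hb.trans_le <| (hwb x).trans <|
    tsupport_excess_subset hv.contDiff.continuous hw.continuous hx
  have hlower : F b * ∫ q, ζ q ≤ ∫ q, F (v q) * ζ q := by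
    rw [← integral_const_mul]
    have hFv := hFc.comp_continuous hv.contDiff.continuous hv.nonneg
    refine integral_mono (hζi.const_mul _)
      ((hFv.mul hζ.continuous).integrable_of_hasCompactSupport hζc.mul_left) fun x => ?_
    rcases le_total (v x) (w x) with h | h
    · simp [ζ, excess_eq_zero_of_le h]
    · exact mul_le_mul_of_nonneg_right (hFm hb.le (hv.nonneg x) ((hwb x).trans h)) (hζ0 x)
  have hupper : ∫ q, F (v q) * ζ q ≤ κ * ∫ q, ζ q :=
    calc _ ≤ -∫ q, inner ℝ (flux φ (gradH v q)) (gradH ζ q) := hv.weak_ineq ζ hζ hζc hζ0 hζv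
      _ ≤ -∫ q, inner ℝ (flux φ (gradH w q)) (gradH ζ q) := neg_le_neg <|
        integral_inner_flux_gradH_excess_le hφ hφm hφ0 hv.contDiff hw hΩ hΩc hvw
      _ ≤ _ := hw_super ζ hζ hζc hζ0 fun _ => excess_eq_zero_of_notMem
  have hint : ∫ q, ζ q = 0 := by
    refine le_antisymm (not_lt.1 fun hpos => ?_) (integral_nonneg hζ0)
    exact (hlower.trans hupper).not_gt (mul_lt_mul_of_pos_right hκ hpos)
  rw [integral_eq_zero_iff_of_nonneg hζ0 hζi, hζ.continuous.ae_eq_iff_eq _ continuous_zero]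
    at hint
  exact le_of_excess_eq_zero hq (congrFun hint q)

end Comparison

section GradientTerm

variable {p : ℝ}

lemma deriv_phiP (p : ℝ) {t : ℝ} (ht : 0 < t) : deriv (phiP p) t = (p - 1) * t ^ (p - 2) := by
  have h : HasDerivAt (phiP p) _ t := Real.hasDerivAt_rpow_const (Or.inl ht.ne')
  rw [h.deriv, show p - 1 - 1 = p - 2 by ring]

lemma CondG.exists_le_rpow (hp : 1 < p) {g : ℝ → ℝ} (hG : CondG (phiP p) 0 g) :
    ∃ C : ℝ, 0 < C ∧ ∀ r, 0 ≤ r → g r ≤ C * r ^ p := by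
  obtain ⟨D, hD, hg⟩ := hG
  refine ⟨D * (p - 1), mul_pos hD (sub_pos.2 hp), fun r hr => ?_⟩
  rcases hr.eq_or_lt with rfl | hr
  · simpa [Real.zero_rpow (by linarith : p ≠ 0)] using hg 0 (by simp) 1 one_pos
  · calc g r ≤ D * r ^ 2 * ((p - 1) * r ^ (p - 2)) := by
          simpa [deriv_phiP p hr] using hg 1 (by simp) r hr
      _ = D * (p - 1) * (r ^ (2 : ℝ) * r ^ (p - 2)) := by
          rw [Real.rpow_two]
          ring
      _ = D * (p - 1) * r ^ p := by rw [← Real.rpow_add hr, add_sub_cancel]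

end GradientTerm

lemma contDiff_one_of_hasDerivAt {v v' : ℝ → ℝ} (hv : ∀ x, HasDerivAt v (v' x) x)
    (hv' : Continuous v') : ContDiff ℝ 1 v :=
  contDiff_one_iff_deriv.2
    ⟨fun x => (hv x).differentiableAt, by rwa [funext fun x => (hv x).deriv]⟩

section ExpPrimitive

variable {c s : ℝ} {k : ℝ → ℝ}

/-- The primitive `Ψ` of `exp (c ∫ k)`. Since `(Ψ')^(p-1) = exp (c (p-1) ∫ k)`, the change of
unknown `u ↦ Ψ(u)` absorbs the gradient term `c (p-1) k(u) |∇u|^p` of a `p`-Laplace inequality. -/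
noncomputable def expPrimitive (c : ℝ) (k : ℝ → ℝ) (s : ℝ) : ℝ :=
  ∫ r in (0 : ℝ)..s, Real.exp (c * ∫ x in (0 : ℝ)..r, k x)

lemma continuous_exp_mul_primitive (c : ℝ) (hk : Integrable k) :
    Continuous fun r => Real.exp (c * ∫ x in (0 : ℝ)..r, k x) :=
  Real.continuous_exp.comp (continuous_const.mul (hk.continuous_primitive 0))

lemma hasDerivAt_expPrimitive (c : ℝ) (hk : Integrable k) (s : ℝ) :
    HasDerivAt (expPrimitive c k) (Real.exp (c * ∫ x in (0 : ℝ)..s, k x)) s :=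
  ((continuous_exp_mul_primitive c hk).integral_hasStrictDerivAt 0 s).hasDerivAt

lemma contDiff_expPrimitive (c : ℝ) (hk : Integrable k) : ContDiff ℝ 1 (expPrimitive c k) :=
  contDiff_one_of_hasDerivAt (hasDerivAt_expPrimitive c hk) (continuous_exp_mul_primitive c hk)

lemma one_le_exp_mul_primitive (hc : 0 ≤ c) (hk0 : ∀ x, 0 ≤ k x) (hs : 0 ≤ s) :
    1 ≤ Real.exp (c * ∫ x in (0 : ℝ)..s, k x) :=
  Real.one_le_exp <| mul_nonneg hc <| intervalIntegral.integral_nonneg hs fun x _ => hk0 x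

lemma exp_mul_primitive_le (hc : 0 ≤ c) (hk : Integrable k) (hk0 : ∀ x, 0 ≤ k x) (hs : 0 ≤ s) :
    Real.exp (c * ∫ x in (0 : ℝ)..s, k x) ≤ Real.exp (c * ∫ x, k x) := by
  refine Real.exp_le_exp.2 (mul_le_mul_of_nonneg_left ?_ hc)
  rw [intervalIntegral.integral_of_le hs]
  exact setIntegral_le_integral hk (Eventually.of_forall hk0)

lemma le_expPrimitive (hc : 0 ≤ c) (hk : Integrable k) (hk0 : ∀ x, 0 ≤ k x) (hs : 0 ≤ s) :
    s ≤ expPrimitive c k s := by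
  have hmono := intervalIntegral.integral_mono_on hs
    (intervalIntegrable_const (μ := volume) (c := (1 : ℝ)))
    ((continuous_exp_mul_primitive c hk).intervalIntegrable 0 s)
    fun r hr => one_le_exp_mul_primitive hc hk0 hr.1
  simpa [expPrimitive] using hmono

lemma expPrimitive_le (hc : 0 ≤ c) (hk : Integrable k) (hk0 : ∀ x, 0 ≤ k x) (hs : 0 ≤ s) :
    expPrimitive c k s ≤ Real.exp (c * ∫ x, k x) * s := by
  have hmono := intervalIntegral.integral_mono_on hs
    ((continuous_exp_mul_primitive c hk).intervalIntegrable 0 s)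
    (intervalIntegrable_const (μ := volume) (c := Real.exp (c * ∫ x, k x)))
    fun r hr => exp_mul_primitive_le hc hk hk0 hr.1
  simpa [expPrimitive, mul_comm] using hmono

lemma expPrimitive_pos_iff (hc : 0 ≤ c) (hk : Integrable k) (hk0 : ∀ x, 0 ≤ k x) (hs : 0 ≤ s) :
    0 < expPrimitive c k s ↔ 0 < s :=
  ⟨fun h => pos_of_mul_pos_right (h.trans_le (expPrimitive_le hc hk hk0 hs)) (Real.exp_pos _).le,
    fun h => h.trans_le (le_expPrimitive hc hk hk0 hs)⟩

end ExpPrimitive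

section Transform

variable {m : ℕ} {p c s : ℝ} {f h g k : ℝ → ℝ} {u ζ : Heis m → ℝ}

lemma hasDerivAt_exp_mul_primitive_of_continuousOn (c : ℝ) (hk : Integrable k)
    (hkc : ContinuousOn k (Ioi 0)) (hs : 0 < s) :
    HasDerivAt (fun s => Real.exp (c * ∫ x in (0 : ℝ)..s, k x))
      (Real.exp (c * ∫ x in (0 : ℝ)..s, k x) * (c * k s)) s :=
  ((intervalIntegral.integral_hasDerivAt_right hk.intervalIntegrable
    (hkc.stronglyMeasurableAtFilter isOpen_Ioi s hs)
    (hkc.continuousAt (Ioi_mem_nhds hs))).const_mul c).exp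

lemma contDiffOn_exp_mul_primitive (c : ℝ) (hk : Integrable k) (hkc : ContinuousOn k (Ioi 0)) :
    ContDiffOn ℝ 1 (fun s => Real.exp (c * ∫ x in (0 : ℝ)..s, k x)) (Ioi 0) := by
  rw [← zero_add (1 : WithTop ℕ∞), contDiffOn_succ_iff_deriv_of_isOpen isOpen_Ioi]
  have hderiv := fun s hs => hasDerivAt_exp_mul_primitive_of_continuousOn (s := s) c hk hkc hs
  refine ⟨fun s hs => (hderiv s hs).differentiableAt.differentiableWithinAt, by simp,
    contDiffOn_zero.2 (ContinuousOn.congr ?_ fun s hs => (hderiv s hs).deriv)⟩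
  exact (continuous_exp_mul_primitive c hk).continuousOn.mul (continuousOn_const.mul hkc)

lemma contDiff_exp_mul_primitive_mul (c : ℝ) (hk : Integrable k) (hkc : ContinuousOn k (Ioi 0))
    (hu : ContDiff ℝ 1 u) (hζ : ContDiff ℝ 1 ζ) (hζu : tsupport ζ ⊆ {q | 0 < u q}) :
    ContDiff ℝ 1 fun q => Real.exp (c * ∫ x in (0 : ℝ)..u q, k x) * ζ q :=
  contMDiff_iff_contDiff.1 <| contMDiff_of_tsupport fun q hq => ContDiffAt.contMDiffAt <|
    (((contDiffOn_exp_mul_primitive c hk hkc).contDiffAt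
      (Ioi_mem_nhds (hζu (tsupport_mul_subset_right hq)))).comp q hu.contDiffAt).mul
      hζ.contDiffAt

lemma gradH_exp_mul_primitive_mul (c : ℝ) (hk : Integrable k) (hkc : ContinuousOn k (Ioi 0))
    (hu : ContDiff ℝ 1 u) (hζ : ContDiff ℝ 1 ζ) (hζu : tsupport ζ ⊆ {q | 0 < u q})
    (q : Heis m) :
    gradH (fun q => Real.exp (c * ∫ x in (0 : ℝ)..u q, k x) * ζ q) q =
      Real.exp (c * ∫ x in (0 : ℝ)..u q, k x) • ((c * k (u q) * ζ q) • gradH u q + gradH ζ q) := by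
  by_cases hq : q ∈ tsupport ζ
  · have hE : HasFDerivAt (fun q => Real.exp (c * ∫ x in (0 : ℝ)..u q, k x)) _ q :=
      (hasDerivAt_exp_mul_primitive_of_continuousOn c hk hkc (hζu hq)).comp_hasFDerivAt q
        (hu.differentiable one_ne_zero q).hasFDerivAt
    refine (gradH_eq_of_hasFDerivAt
      (hE.mul (hζ.differentiable one_ne_zero q).hasFDerivAt)).trans ?_
    simp only [map_add, map_smul, ← gradH_eq_horiz, smul_add, smul_smul]
    rw [add_comm]
    congr 2
    ring
  · have hη : q ∉ tsupport fun q => Real.exp (c * ∫ x in (0 : ℝ)..u q, k x) * ζ q :=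
      fun h => hq (tsupport_mul_subset_right h)
    simp [gradH_eq_horiz _ q, fderiv_of_notMem_tsupport ℝ hη, fderiv_of_notMem_tsupport ℝ hq,
      image_eq_zero_of_notMem_tsupport hq]

lemma flux_gradH_expPrimitive_comp (hp : p ≠ 1) (c : ℝ) (hk : Integrable k)
    (hu : ContDiff ℝ 1 u) (q : Heis m) :
    flux (phiP p) (gradH (fun q => expPrimitive (c / (p - 1)) k (u q)) q) =
      Real.exp (c * ∫ x in (0 : ℝ)..u q, k x) • flux (phiP p) (gradH u q) := by
  have hp1 : p - 1 ≠ 0 := sub_ne_zero.2 hp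
  have hgrad : gradH (fun q => expPrimitive (c / (p - 1)) k (u q)) q = _ :=
    gradH_eq_of_hasFDerivAt ((hasDerivAt_expPrimitive _ hk (u q)).comp_hasFDerivAt q
      (hu.differentiable one_ne_zero q).hasFDerivAt)
  rw [hgrad, map_smul, ← gradH_eq_horiz, flux_phiP_smul p (Real.exp_pos _), ← Real.exp_mul]
  congr 2
  field_simp

lemma inner_flux_gradH_exp_mul_primitive_mul (hp : 1 < p) (c : ℝ) (hk : Integrable k)
    (hkc : ContinuousOn k (Ioi 0)) (hu : ContDiff ℝ 1 u) (hζ : ContDiff ℝ 1 ζ)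
    (hζu : tsupport ζ ⊆ {q | 0 < u q}) (q : Heis m) :
    inner ℝ (flux (phiP p) (gradH u q))
        (gradH (fun q => Real.exp (c * ∫ x in (0 : ℝ)..u q, k x) * ζ q) q) =
      k (u q) * (c * ‖gradH u q‖ ^ p) * (Real.exp (c * ∫ x in (0 : ℝ)..u q, k x) * ζ q) +
      inner ℝ (flux (phiP p) (gradH (fun q => expPrimitive (c / (p - 1)) k (u q)) q))
        (gradH ζ q) := by
  rw [gradH_exp_mul_primitive_mul c hk hkc hu hζ hζu, flux_gradH_expPrimitive_comp hp.ne' c hk hu,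
    real_inner_smul_left, real_inner_smul_right, inner_add_right, real_inner_smul_right,
    inner_flux_phiP_self (by linarith)]
  ring

lemma CondF.comp_expPrimitive_div_le (hp : 1 ≤ p) (hF : CondF f) (hk : Integrable k)
    (hk0 : ∀ x, 0 ≤ k x) (hc : 0 ≤ c) (hg : ∀ r, 0 ≤ r → g r ≤ c * r ^ p) (hs : 0 < s) {r : ℝ}
    (hr : 0 ≤ r) :
    f (expPrimitive (c / (p - 1)) k s / Real.exp (c / (p - 1) * ∫ x, k x)) ≤
      (f s - k s * g r + k s * (c * r ^ p)) * Real.exp (c * ∫ x in (0 : ℝ)..s, k x) := by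
  have hc' : 0 ≤ c / (p - 1) := div_nonneg hc (sub_nonneg.2 hp)
  have harg : expPrimitive (c / (p - 1)) k s / Real.exp (c / (p - 1) * ∫ x, k x) ≤ s :=
    (div_le_iff₀' (Real.exp_pos _)).2 (expPrimitive_le hc' hk hk0 hs.le)
  have harg0 : 0 ≤ expPrimitive (c / (p - 1)) k s / Real.exp (c / (p - 1) * ∫ x, k x) :=
    div_nonneg (hs.le.trans (le_expPrimitive hc' hk hk0 hs.le)) (Real.exp_pos _).le
  calc _ ≤ f s := hF.monotoneOn harg0 hs.le harg
    _ ≤ f s - k s * g r + k s * (c * r ^ p) := by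
      linarith [mul_le_mul_of_nonneg_left (hg r hr) (hk0 s)]
    _ ≤ _ := le_mul_of_one_le_right
      (by linarith [mul_le_mul_of_nonneg_left (hg r hr) (hk0 s), hF.pos s hs])
      (one_le_exp_mul_primitive hc hk0 hs.le)

lemma CondF.pointwise_expPrimitive_le (hp : 1 < p) (hF : CondF f) (hk : Integrable k)
    (hk0 : ∀ x, 0 ≤ k x) (hkc : ContinuousOn k (Ioi 0)) (hkh : EqOn k h (Ioi 0)) (hc : 0 ≤ c)
    (hg : ∀ r, 0 ≤ r → g r ≤ c * r ^ p) (hu : ContDiff ℝ 1 u) (hζ : ContDiff ℝ 1 ζ)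
    (hζ0 : ∀ q, 0 ≤ ζ q) (hζu : tsupport ζ ⊆ {q | 0 < u q}) (q : Heis m) :
    f (expPrimitive (c / (p - 1)) k (u q) / Real.exp (c / (p - 1) * ∫ x, k x)) * ζ q +
        inner ℝ (flux (phiP p) (gradH (fun q => expPrimitive (c / (p - 1)) k (u q)) q))
          (gradH ζ q) ≤
      (f (u q) - h (u q) * g ‖gradH u q‖) * (Real.exp (c * ∫ x in (0 : ℝ)..u q, k x) * ζ q) +
        inner ℝ (flux (phiP p) (gradH u q))
          (gradH (fun q => Real.exp (c * ∫ x in (0 : ℝ)..u q, k x) * ζ q) q) := by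
  rw [inner_flux_gradH_exp_mul_primitive_mul hp c hk hkc hu hζ hζu, ← add_assoc, ← add_mul]
  refine add_le_add_left ?_ _
  by_cases hq : q ∈ tsupport ζ
  · rw [← hkh (hζu hq), ← mul_assoc]
    exact mul_le_mul_of_nonneg_right
      (hF.comp_expPrimitive_div_le hp.le hk hk0 hc hg (hζu hq) (norm_nonneg _)) (hζ0 q)
  · simp [image_eq_zero_of_notMem_tsupport hq]

theorem IsWeakSolution.isPosSubsolution_expPrimitive (hp : 1 < p) (hF : CondF f)
    (hk : Integrable k) (hk0 : ∀ x, 0 ≤ k x) (hkc : ContinuousOn k (Ioi 0))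
    (hkh : EqOn k h (Ioi 0)) (hc : 0 ≤ c) (hg : ∀ r, 0 ≤ r → g r ≤ c * r ^ p)
    (hu : IsWeakSolution (phiP p) f h g u) (hu0 : ∀ q, 0 ≤ u q) :
    IsPosSubsolution (phiP p) (fun t => f (t / Real.exp (c / (p - 1) * ∫ x, k x)))
      (fun q => expPrimitive (c / (p - 1)) k (u q)) := by
  set v : Heis m → ℝ := fun q => expPrimitive (c / (p - 1)) k (u q)
  set M := Real.exp (c / (p - 1) * ∫ x, k x)
  have hc' : 0 ≤ c / (p - 1) := div_nonneg hc (sub_pos.2 hp).le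
  have hv0 : ∀ q, 0 ≤ v q := fun q => (hu0 q).trans (le_expPrimitive hc' hk hk0 (hu0 q))
  have hv : ContDiff ℝ 1 v := (contDiff_expPrimitive (c / (p - 1)) hk).comp hu.contDiff
  refine ⟨hv, hv0, fun ζ hζ hζc hζ0 hζv => ?_⟩
  have hζu : tsupport ζ ⊆ {q | 0 < u q} := fun q hq =>
    (expPrimitive_pos_iff hc' hk hk0 (hu0 q)).1 (hζv hq)
  set η : Heis m → ℝ := fun q => Real.exp (c * ∫ x in (0 : ℝ)..u q, k x) * ζ q
  have hη : ContDiff ℝ 1 η := contDiff_exp_mul_primitive_mul c hk hkc hu.contDiff hζ hζu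
  have hηc : HasCompactSupport η := hζc.mul_left
  have hweak := hu.weak_ineq_of_contDiff_one (continuous_phiP hp.le).continuousOn
    (phiP_zero hp.ne') hη hηc fun q => mul_nonneg (Real.exp_pos _).le (hζ0 q)
  have hint_fv : Integrable fun q => f (v q / M) * ζ q :=
    ((hF.continuousOn.comp_continuous (hv.continuous.div_const M) fun q =>
      div_nonneg (hv0 q) (Real.exp_pos _).le).mul hζ.continuous).integrable_of_hasCompactSupport
      hζc.mul_left
  have hint_v := integrable_inner_gradH
    ((continuous_flux_phiP hp).comp (continuous_gradH hv)) hζ hζc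
  have hint_u := integrable_inner_gradH
    ((continuous_flux_phiP hp).comp (continuous_gradH hu.contDiff)) hη hηc
  have hint_rhs : Integrable fun q => (f (u q) - h (u q) * g ‖gradH u q‖) * η q :=
    hu.locallyIntegrable.integrable_smul_right_of_hasCompactSupport hη.continuous hηc
  have hmono := integral_mono (hint_fv.add hint_v) (hint_rhs.add hint_u)
    (hF.pointwise_expPrimitive_le hp hk hk0 hkc hkh hc hg hu.contDiff hζ hζ0 hζu)
  rw [integral_add' hint_fv hint_v, integral_add' hint_rhs hint_u] at hmono
  simp only [Function.comp_apply] at hmono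
  linarith

theorem IsWeakSolution.exists_isPosSubsolution (hp : 1 < p) (hF : CondF f) (hH : CondH h)
    (hL1 : IntegrableOn h (Ioi 0)) (hG : CondG (phiP p) 0 g)
    (hu : IsWeakSolution (phiP p) f h g u) (hu0 : ∀ q, 0 ≤ u q) :
    ∃ M > 0, ∃ v, IsPosSubsolution (phiP p) (fun t => f (t / M)) v ∧ ∀ q, u q ≤ v q := by
  obtain ⟨c, hc, hg⟩ := hG.exists_le_rpow hp
  have hk : Integrable ((Ioi 0).indicator h) :=
    (integrable_indicator_iff measurableSet_Ioi).2 hL1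
  have hk0 : ∀ x, 0 ≤ (Ioi 0).indicator h x := indicator_nonneg hH.nonneg
  have hkh : EqOn ((Ioi 0).indicator h) h (Ioi 0) := fun _ hr => indicator_of_mem hr h
  exact ⟨_, Real.exp_pos _, _, hu.isPosSubsolution_expPrimitive hp hF hk hk0
    (hH.continuousOn.congr hkh) hkh hc.le hg hu0,
    fun q => le_expPrimitive (div_nonneg hc.le (sub_pos.2 hp).le) hk hk0 (hu0 q)⟩

end Transform

section KellerOsserman

variable {p : ℝ} {f : ℝ → ℝ}

lemma K_phiP (hp : 1 < p) {t : ℝ} (ht : 0 ≤ t) : K (phiP p) t = (p - 1) / p * t ^ p := by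
  have h : K (phiP p) t = ∫ s in (0 : ℝ)..t, (p - 1) * s ^ (p - 1) := by
    refine intervalIntegral.integral_congr_uIoo fun s hs => ?_
    rw [uIoo_of_le ht] at hs
    simp only [deriv_phiP p hs.1]
    rw [show p - 1 = (p - 2) + 1 by ring, Real.rpow_add_one hs.1.ne']
    ring
  rw [h, intervalIntegral.integral_const_mul, integral_rpow (Or.inl (by linarith)),
    sub_add_cancel, Real.zero_rpow (by linarith), sub_zero]
  ring

lemma Kinv_phiP (hp : 1 < p) {s : ℝ} (hs : 0 ≤ s) :
    Kinv (phiP p) s = (p / (p - 1) * s) ^ p⁻¹ := by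
  have hp0 : 0 < p := by linarith
  have hp1 : 0 < p - 1 := by linarith
  have hex : ∃ r ∈ Ici (0 : ℝ), K (phiP p) r = s := by
    refine ⟨(p / (p - 1) * s) ^ p⁻¹, Real.rpow_nonneg (by positivity) _, ?_⟩
    rw [K_phiP hp (Real.rpow_nonneg (by positivity) _),
      Real.rpow_inv_rpow (by positivity) hp0.ne']
    field_simp
  have hK : K (phiP p) (Kinv (phiP p) s) = s := Function.invFunOn_eq hex
  have hr : 0 ≤ Kinv (phiP p) s := Function.invFunOn_mem hex
  rw [K_phiP hp hr] at hK
  rw [Real.eq_rpow_inv hr (by positivity) hp0.ne']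
  generalize Kinv (phiP p) s ^ p = y at hK
  rw [← hK]
  field_simp

lemma one_div_Kinv_phiP (hp : 1 < p) {s : ℝ} (hs : 0 ≤ s) :
    1 / Kinv (phiP p) s = (p / (p - 1)) ^ (-p⁻¹) * s ^ (-p⁻¹) := by
  have hc : 0 ≤ p / (p - 1) := div_nonneg (by linarith) (by linarith)
  rw [Kinv_phiP hp hs, one_div, ← Real.rpow_neg (mul_nonneg hc hs), Real.mul_rpow hc hs]

lemma CondF.nonneg (hF : CondF f) {t : ℝ} (ht : 0 ≤ t) : 0 ≤ f t := by
  refine ge_of_tendsto ((hF.continuousOn.continuousWithinAt ht).mono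
    (Ioi_subset_Ici ht) : ContinuousWithinAt f (Ioi t) t) ?_
  filter_upwards [self_mem_nhdsWithin] with s hs
  exact (hF.pos s (ht.trans_lt hs)).le

lemma CondF.intervalIntegrable (hF : CondF f) {a b : ℝ} (ha : 0 ≤ a) (hb : 0 ≤ b) :
    IntervalIntegrable f volume a b :=
  (hF.continuousOn.mono fun _ hx => (le_inf ha hb).trans hx.1).intervalIntegrable

lemma CondF.primF_le (hF : CondF f) {t : ℝ} (ht : 0 ≤ t) : primF f t ≤ t * f t := by
  have h := intervalIntegral.integral_mono_on ht (hF.intervalIntegrable le_rfl ht)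
    (intervalIntegrable_const (μ := volume) (c := f t)) fun r hr => hF.monotoneOn hr.1 ht hr.2
  simpa [primF] using h

lemma CondF.primF_pos (hF : CondF f) {t : ℝ} (ht : 0 < t) : 0 < primF f t :=
  intervalIntegral.intervalIntegral_pos_of_pos_on (hF.intervalIntegrable le_rfl ht.le)
    (fun s hs => hF.pos s hs.1) ht

lemma kellerOsserman_phiP_iff (hp : 1 < p) (hF : CondF f) :
    KellerOsserman (phiP p) f ↔ ∃ a > 0, IntegrableOn (fun t => primF f t ^ (-p⁻¹)) (Ioi a) := by
  have hc : 0 < (p / (p - 1)) ^ (-p⁻¹) :=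
    Real.rpow_pos_of_pos (div_pos (by linarith) (by linarith)) _
  have hiff : ∀ a > 0, IntegrableOn (fun t => 1 / Kinv (phiP p) (primF f t)) (Ioi a) ↔
      IntegrableOn (fun t => primF f t ^ (-p⁻¹)) (Ioi a) := fun a ha => by
    have hcongr : EqOn (fun t => 1 / Kinv (phiP p) (primF f t))
        (fun t => (p / (p - 1)) ^ (-p⁻¹) * primF f t ^ (-p⁻¹)) (Ioi a) := fun t ht =>
      one_div_Kinv_phiP hp (hF.primF_pos (ha.trans ht)).le
    rw [integrableOn_congr_fun hcongr measurableSet_Ioi]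
    exact integrable_const_mul_iff hc.ne'.isUnit _
  rw [KellerOsserman, integrableAtFilter_atTop_iff]
  constructor
  · rintro ⟨a, ha⟩
    have ha1 : 0 < max a 1 := by positivity
    exact ⟨_, ha1, (hiff _ ha1).1 (ha.mono_set fun t ht => (le_max_left a 1).trans (le_of_lt ht))⟩
  · rintro ⟨a, ha0, ha⟩
    exact ⟨a + 1, ((hiff a ha0).2 ha).mono_set (Ici_subset_Ioi.2 (lt_add_one a))⟩

lemma CondF.comp_div (hF : CondF f) {M : ℝ} (hM : 0 < M) : CondF fun t => f (t / M) where
  continuousOn := hF.continuousOn.comp (by fun_prop) fun _ ht => div_nonneg ht hM.le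
  pos _ ht := hF.pos _ (div_pos ht hM)
  monotoneOn _ ha _ hb hab :=
    hF.monotoneOn (div_nonneg ha hM.le) (div_nonneg hb hM.le) (by gcongr)

lemma primF_comp_div {M : ℝ} (hM : M ≠ 0) (t : ℝ) :
    primF (fun s => f (s / M)) t = M * primF f (t / M) := by
  simp [primF, intervalIntegral.integral_comp_div f hM]

lemma KellerOsserman.comp_div (hp : 1 < p) (hF : CondF f) (hKO : KellerOsserman (phiP p) f)
    {M : ℝ} (hM : 0 < M) : KellerOsserman (phiP p) fun t => f (t / M) := by
  obtain ⟨a, ha, hint⟩ := (kellerOsserman_phiP_iff hp hF).1 hKO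
  refine (kellerOsserman_phiP_iff hp (hF.comp_div hM)).2 ⟨a * M, by positivity, ?_⟩
  have hscale : IntegrableOn (fun t => primF f (t * M⁻¹) ^ (-p⁻¹)) (Ioi (a * M)) := by
    rw [integrableOn_Ioi_comp_mul_right_iff (fun t => primF f t ^ (-p⁻¹)) _ (inv_pos.2 hM),
      mul_inv_cancel_right₀ hM.ne']
    exact hint
  refine IntegrableOn.congr_fun (hscale.const_mul (M ^ (-p⁻¹))) (fun t ht => ?_) measurableSet_Ioi
  have ht0 : 0 < t / M := div_pos ((mul_pos ha hM).trans ht) hM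
  simp only [primF_comp_div hM.ne', Real.mul_rpow hM.le (hF.primF_pos ht0).le]
  rw [div_eq_mul_inv]

lemma CondF.antitoneOn_mul_self_rpow (hF : CondF f) {s : ℝ} (hs : s ≤ 0) :
    AntitoneOn (fun t => (t * f t) ^ s) (Ioi 0) := fun a ha _ hb hab =>
  Real.rpow_le_rpow_of_nonpos (mul_pos ha (hF.pos a ha))
    (mul_le_mul hab (hF.monotoneOn (Ioi_subset_Ici_self ha) (Ioi_subset_Ici_self hb) hab)
      (hF.pos a ha).le (le_of_lt hb)) hs

lemma KellerOsserman.exists_integrableOn (hp : 1 < p) (hF : CondF f)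
    (hKO : KellerOsserman (phiP p) f) :
    ∃ a > 0, IntegrableOn (fun t => (t * f t) ^ (-p⁻¹)) (Ioi a) := by
  obtain ⟨a, ha, hint⟩ := (kellerOsserman_phiP_iff hp hF).1 hKO
  refine ⟨a, ha, hint.mono' ?_ ((ae_restrict_iff' measurableSet_Ioi).2 (.of_forall fun t ht => ?_))⟩
  · refine ContinuousOn.aestronglyMeasurable ?_ measurableSet_Ioi
    have hfc : ContinuousOn f (Ioi a) := hF.continuousOn.mono fun t ht => (ha.trans ht).le
    exact (continuousOn_id.mul hfc).rpow_const fun t ht =>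
      Or.inl (mul_pos (ha.trans ht) (hF.pos t (ha.trans ht))).ne'
  · have ht0 : 0 < t := ha.trans ht
    rw [Real.norm_of_nonneg (Real.rpow_nonneg (mul_pos ht0 (hF.pos t ht0)).le _)]
    exact Real.rpow_le_rpow_of_nonpos (hF.primF_pos ht0) (hF.primF_le ht0.le)
      (neg_nonpos.2 (inv_nonneg.2 (by linarith)))

lemma KellerOsserman.summable (hp : 1 < p) (hF : CondF f) (hKO : KellerOsserman (phiP p) f) :
    Summable fun k : ℕ => (((2 : ℝ) ^ k) ^ (p - 1) / f (2 ^ k)) ^ p⁻¹ := by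
  have hp0 : 0 < p := by linarith
  obtain ⟨a, ha, hint⟩ := hKO.exists_integrableOn hp hF
  obtain ⟨N, hN⟩ := exists_nat_gt a
  have hN0 : (0 : ℝ) < N := ha.trans hN
  have hanti := hF.antitoneOn_mul_self_rpow (neg_nonpos.2 (inv_nonneg.2 hp0.le))
  have hnonneg : ∀ t, 0 ≤ t → 0 ≤ (t * f t) ^ (-p⁻¹) := fun t ht =>
    Real.rpow_nonneg (mul_nonneg ht (hF.nonneg ht)) _
  have hsum : Summable fun n : ℕ => ((n : ℝ) * f n) ^ (-p⁻¹) :=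
    (hanti.mono fun t ht => hN0.trans_le ht).summable_of_integrableOn_Ioi
      (hint.mono_set (Ioi_subset_Ioi hN.le)) fun t ht => hnonneg t (hN0.trans ht).le
  rw [← summable_condensed_iff_of_nonneg (fun n => hnonneg n n.cast_nonneg) fun a b ha hab =>
    hanti (mem_Ioi.2 (Nat.cast_pos.2 ha)) (mem_Ioi.2 (Nat.cast_pos.2 (ha.trans_le hab)))
      (Nat.cast_le.2 hab)] at hsum
  refine hsum.congr fun k => ?_
  have hx : (0 : ℝ) < 2 ^ k := by positivity
  have hy := hF.pos _ hx
  simp only [Nat.cast_pow, Nat.cast_ofNat]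
  generalize (2 : ℝ) ^ k = x at hx hy
  have hquot : x ^ (p - 1) / f x = x ^ p * (x * f x)⁻¹ := by
    rw [Real.rpow_sub_one hx.ne']
    field_simp
  rw [hquot, Real.mul_rpow (x := x ^ p) (by positivity) (by positivity),
    Real.rpow_rpow_inv hx.le hp0.ne', Real.rpow_neg (by positivity),
    Real.inv_rpow (by positivity)]

end KellerOsserman

section Liouville

variable {m : ℕ} {p : ℝ} {f : ℝ → ℝ} {v : Heis m → ℝ}

lemma isCompact_closure_gaugeN_lt (L : ℝ) : IsCompact (closure {q : Heis m | gaugeN q < L}) :=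
  (isCompact_gaugeN_le L).of_isClosed_subset isClosed_closure
    (closure_lt_subset_le continuous_gaugeN continuous_const)

lemma IsPosSubsolution.le_add_mul_gaugeN_rpow (hp : 1 < p) (hF : CondF f)
    (hv : IsPosSubsolution (phiP p) f v) {b A L lam : ℝ} (hb : 0 < b) (hA : 0 < A) (hL : 0 < L)
    (hlam : 1 + 3 / (2 * (p - 1)) ≤ lam)
    (hκ : (4 * A * lam) ^ (p - 1) * ((4 * p + 2 * m) * lam) * L ^ (-(p / 4)) < f b)
    (hbd : ∀ q, gaugeN q = L → v q < b + A) {q : Heis m} (hq : gaugeN q < L) :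
    v q ≤ b + A * (gaugeN q / L) ^ lam := by
  have hp1 : 0 < p - 1 := by linarith
  have hlam1 : 1 ≤ lam := (le_add_of_nonneg_right (by positivity)).trans hlam
  have hμ : 1 ≤ (lam - 1 / 2) * (p - 1) - 1 / 2 := by
    have : 3 / (2 * (p - 1)) * (p - 1) = 3 / 2 := by field_simp
    nlinarith
  have hc : 0 < A * L ^ (-lam) := by positivity
  have hcL : A * L ^ (-lam) * L ^ lam = A := by
    rw [mul_assoc, ← Real.rpow_add hL, neg_add_cancel, Real.rpow_zero, mul_one]
  have hκ' : (4 * (A * L ^ (-lam)) * lam) ^ (p - 1) *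
      ((4 * p + 2 * m) * lam * L ^ (lam * (p - 1) - p / 4)) < f b := by
    refine lt_of_eq_of_lt ?_ hκ
    have h₁ : (4 * (A * L ^ (-lam)) * lam) ^ (p - 1) =
        (4 * A * lam) ^ (p - 1) * L ^ (-lam * (p - 1)) := by
      rw [Real.rpow_mul hL.le, ← Real.mul_rpow (by positivity) (by positivity)]
      congr 1
      ring
    have h₂ : L ^ (-(p / 4)) = L ^ (-lam * (p - 1)) * L ^ (lam * (p - 1) - p / 4) := by
      rw [← Real.rpow_add hL]
      congr 1
      ring
    rw [h₁, h₂]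
    ring
  have hle := hv.le_of_forall_frontier_lt (continuous_phiP hp.le).continuousOn
    (monotoneOn_phiP hp.le) (phiP_zero hp.ne') hF.continuousOn hF.monotoneOn
    (contDiff_const_add_gaugeN_rpow hlam1 b (A * L ^ (-lam))) hb
    (fun q => le_add_of_nonneg_right (mul_nonneg hc.le (Real.rpow_nonneg (gaugeN_nonneg q) _)))
    hκ' (isOpen_lt continuous_gaugeN continuous_const) (isCompact_closure_gaugeN_lt L)
    (fun q hq => ?_) (fun ζ hζ hζc hζ0 hζΩ => ?_) hq
  · rwa [Real.div_rpow (gaugeN_nonneg q) hL.le, div_eq_mul_inv, ← Real.rpow_neg hL.le, mul_comm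
      (gaugeN q ^ lam), ← mul_assoc]
  · have hqL : gaugeN q = L := frontier_lt_subset_eq continuous_gaugeN continuous_const hq
    rw [hqL, hcL]
    exact hbd q hqL
  · exact neg_integral_inner_flux_gradH_gaugeN_rpow_le hp.le hlam1 hμ b hc hL hζ hζc hζ0
      fun q hq => hζΩ q hq.not_gt

lemma IsPosSubsolution.eq_zero_of_forall_lt (hp : 1 < p) (hF : CondF f)
    (hv : IsPosSubsolution (phiP p) f v) {A : ℝ} (hA : ∀ q, v q < A) (q : Heis m) : v q = 0 := by
  by_contra hne
  have hvq : 0 < v q := (hv.nonneg q).lt_of_ne' hne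
  have hA0 : 0 < A := hvq.trans (hA q)
  have : 0 < p - 1 := by linarith
  set lam := 1 + 3 / (2 * (p - 1))
  have hlam0 : 0 < lam := by positivity
  have hκ : Tendsto (fun L : ℝ => (4 * A * lam) ^ (p - 1) * ((4 * p + 2 * m) * lam) *
      L ^ (-(p / 4))) atTop (𝓝 0) := by
    simpa using (tendsto_rpow_neg_atTop (by positivity : 0 < p / 4)).const_mul
      ((4 * A * lam) ^ (p - 1) * ((4 * p + 2 * m) * lam))
  have hpow : Tendsto (fun L : ℝ => A * (gaugeN q / L) ^ lam) atTop (𝓝 0) := by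
    have : Tendsto (fun L : ℝ => (gaugeN q / L) ^ lam) atTop (𝓝 (0 ^ lam)) :=
      (tendsto_const_nhds.div_atTop tendsto_id).rpow_const (Or.inr hlam0.le)
    simpa [Real.zero_rpow hlam0.ne'] using this.const_mul A
  obtain ⟨L, hκL, hpowL, hL, hqL⟩ :=
    ((hκ.eventually (gt_mem_nhds (hF.pos _ (half_pos hvq)))).and
      ((hpow.eventually (gt_mem_nhds (half_pos hvq))).and
        ((eventually_gt_atTop 0).and (eventually_gt_atTop (gaugeN q))))).exists
  have := hv.le_add_mul_gaugeN_rpow hp hF (half_pos hvq) hA0 hL le_rfl hκL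
    (fun q' _ => (hA q').trans (by linarith)) hqL
  linarith

lemma IsPosSubsolution.exists_two_mul_le (hp : 1 < p) (hF : CondF f)
    (hv : IsPosSubsolution (phiP p) f v) {a L s : ℝ} (ha : 0 < a) (hL : 1 ≤ L) (hs : 0 < s)
    (hlam : 1 + 3 / (2 * (p - 1)) ≤ s⁻¹)
    (hκ : (8 * a) ^ (p - 1) * (4 * p + 2 * m) < f (a / 2) * s ^ p)
    (hq : ∃ q, gaugeN q ≤ L ∧ a ≤ v q) : ∃ q, gaugeN q ≤ L * 5 ^ s ∧ 2 * a ≤ v q := by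
  by_contra! hcon
  obtain ⟨q, hqL, hqa⟩ := hq
  have h5 : (1 : ℝ) < 5 ^ s := Real.one_lt_rpow (by norm_num) hs
  have hL0 : 0 < L := by linarith
  have hL5 : 1 ≤ L * 5 ^ s := one_le_mul_of_one_le_of_one_le hL h5.le
  have hκ' : (4 * (2 * a) * s⁻¹) ^ (p - 1) * ((4 * p + 2 * m) * s⁻¹) *
      (L * 5 ^ s) ^ (-(p / 4)) < f (a / 2) := by
    have hsp : s ^ p = s ^ (p - 1) * s := by rw [← Real.rpow_add_one hs.ne', sub_add_cancel]
    calc (4 * (2 * a) * s⁻¹) ^ (p - 1) * ((4 * p + 2 * m) * s⁻¹) * (L * 5 ^ s) ^ (-(p / 4))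
        ≤ (4 * (2 * a) * s⁻¹) ^ (p - 1) * ((4 * p + 2 * m) * s⁻¹) :=
          mul_le_of_le_one_right (by positivity)
            (Real.rpow_le_one_of_one_le_of_nonpos hL5 (by linarith))
      _ = (8 * a) ^ (p - 1) * (4 * p + 2 * m) / s ^ p := by
          rw [Real.mul_rpow (by positivity) (by positivity), Real.inv_rpow hs.le, hsp,
            show 4 * (2 * a) = 8 * a by ring]
          field_simp
      _ < f (a / 2) := (div_lt_iff₀ (by positivity)).2 hκ
  have hle := hv.le_add_mul_gaugeN_rpow hp hF (half_pos ha) (by positivity : 0 < 2 * a)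
    (by positivity : 0 < L * 5 ^ s) hlam hκ' (fun q' hq' => (hcon q' hq'.le).trans (by linarith))
    (hqL.trans_lt (lt_mul_of_one_lt_right hL0 h5))
  have hfifth : (gaugeN q / (L * 5 ^ s)) ^ s⁻¹ ≤ 5⁻¹ := by
    have hquot : gaugeN q / (L * 5 ^ s) ≤ (5⁻¹ : ℝ) ^ s := by
      rw [Real.inv_rpow (by norm_num), div_le_iff₀ (by positivity)]
      field_simp
      exact hqL
    refine (Real.rpow_le_rpow (div_nonneg (gaugeN_nonneg q) (by positivity)) hquot
      (inv_nonneg.2 hs.le)).trans_eq (Real.rpow_rpow_inv (by norm_num) hs.ne')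
  nlinarith

lemma exists_forall_of_summable_step {P : ℕ → ℝ → Prop} (hmono : ∀ k, Monotone (P k))
    {s : ℕ → ℝ} (hs0 : ∀ k, 0 ≤ s k) (hs : Summable s) {c : ℝ} (hc : 1 ≤ c)
    (hstep : ∀ k L, 1 ≤ L → P k L → P (k + 1) (L * c ^ s k)) {L₀ : ℝ} (hL₀ : 1 ≤ L₀)
    (hP : P 0 L₀) : ∃ L, ∀ k, P k L := by
  have hc0 : 0 < c := by linarith
  have hiter : ∀ k, P k (L₀ * c ^ ∑ i ∈ Finset.range k, s i) := by
    intro k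
    induction k with
    | zero => simpa using hP
    | succ k ih =>
      rw [Finset.sum_range_succ, Real.rpow_add hc0, ← mul_assoc]
      exact hstep k _ (one_le_mul_of_one_le_of_one_le hL₀
        (Real.one_le_rpow hc (Finset.sum_nonneg fun i _ => hs0 i))) ih
  refine ⟨L₀ * c ^ ∑' i, s i, fun k => hmono k ?_ (hiter k)⟩
  gcongr
  exact hs.sum_le_tsum _ fun i _ => hs0 i

lemma KellerOsserman.exists_summable_rpow_mul_lt (hp : 1 < p) (hF : CondF f)
    (hKO : KellerOsserman (phiP p) f) {C : ℝ} (hC : 0 < C) :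
    ∃ s : ℕ → ℝ, (∀ k, 0 < s k) ∧ Summable s ∧
      ∀ k, (8 * 2 ^ (k + 1)) ^ (p - 1) * C < f (2 ^ (k + 1) / 2) * s k ^ p := by
  have hp0 : p ≠ 0 := by linarith
  have hf : ∀ k : ℕ, 0 < f (2 ^ k) := fun k => hF.pos _ (by positivity)
  refine ⟨fun k => (2 * (16 ^ (p - 1) * C)) ^ p⁻¹ * (((2 : ℝ) ^ k) ^ (p - 1) / f (2 ^ k)) ^ p⁻¹,
    fun k => by have := hf k; positivity, (hKO.summable hp hF).mul_left _, fun k => ?_⟩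
  have hfk := hf k
  have hleft : ((8 : ℝ) * 2 ^ (k + 1)) ^ (p - 1) * C = 16 ^ (p - 1) * C * (2 ^ k) ^ (p - 1) := by
    rw [show (8 : ℝ) * 2 ^ (k + 1) = 16 * 2 ^ k by ring,
      Real.mul_rpow (by positivity) (by positivity)]
    ring
  have hright : f (2 ^ (k + 1) / 2) * ((2 * (16 ^ (p - 1) * C)) ^ p⁻¹ *
      (((2 : ℝ) ^ k) ^ (p - 1) / f (2 ^ k)) ^ p⁻¹) ^ p =
        2 * (16 ^ (p - 1) * C * (2 ^ k) ^ (p - 1)) := by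
    rw [Real.mul_rpow (by positivity) (by positivity), Real.rpow_inv_rpow (by positivity) hp0,
      Real.rpow_inv_rpow (by positivity) hp0, pow_succ, mul_div_cancel_right₀ _ two_ne_zero]
    field_simp
  rw [hleft, hright]
  exact lt_two_mul_self (by positivity)

/- The radii `L` on which `v` reaches `2 ^ (k + 1)` grow by the factor `5 ^ s k`, and the
Keller-Osserman condition makes `∑ s k` converge: `v` would be unbounded on a compact set. -/
lemma IsPosSubsolution.eq_zero_of_kellerOsserman (hp : 1 < p) (hF : CondF f)
    (hKO : KellerOsserman (phiP p) f) (hv : IsPosSubsolution (phiP p) f v) (q : Heis m) :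
    v q = 0 := by
  have : 0 < p - 1 := by linarith
  by_contra hne
  have hunbdd : ∀ A, ∃ q, A ≤ v q := by
    by_contra! ⟨A, hA⟩
    exact hne (hv.eq_zero_of_forall_lt hp hF hA q)
  obtain ⟨s, hs0, hsum, hκ⟩ :=
    hKO.exists_summable_rpow_mul_lt hp hF (by positivity : 0 < 4 * p + 2 * m)
  obtain ⟨k₀, hk₀⟩ : ∃ k₀, ∀ k ≥ k₀, s k < (1 + 3 / (2 * (p - 1)))⁻¹ :=
    eventually_atTop.1 (hsum.tendsto_atTop_zero.eventually (gt_mem_nhds (by positivity)))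
  obtain ⟨q₀, hq₀⟩ := hunbdd (2 ^ (k₀ + 1))
  obtain ⟨L, hL⟩ := exists_forall_of_summable_step
    (P := fun k L => ∃ q, gaugeN q ≤ L ∧ 2 ^ (k₀ + k + 1) ≤ v q)
    (fun k L L' hLL' ⟨q, hqL, hqv⟩ => ⟨q, hqL.trans hLL', hqv⟩)
    (fun k => (hs0 (k₀ + k)).le) (hsum.comp_injective (add_right_injective k₀))
    (by norm_num : (1 : ℝ) ≤ 5)
    (fun k L hL hq => by
      rw [← add_assoc, pow_succ' 2 (k₀ + k + 1)]
      exact hv.exists_two_mul_le hp hF (by positivity) hL (hs0 _)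
        ((le_inv_comm₀ (by positivity) (hs0 _)).2 (hk₀ _ (by omega)).le) (hκ _) hq)
    (le_max_left 1 (gaugeN q₀)) ⟨q₀, le_max_right _ _, hq₀⟩
  obtain ⟨B, hB⟩ := (isCompact_gaugeN_le L).exists_bound_of_continuousOn
    hv.contDiff.continuous.continuousOn
  obtain ⟨k, hk⟩ := pow_unbounded_of_one_lt B (one_lt_two (α := ℝ))
  obtain ⟨q, hqL, hqv⟩ := hL k
  have hmono : (2 : ℝ) ^ k ≤ 2 ^ (k₀ + k + 1) := pow_le_pow_right₀ one_le_two (by omega)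
  linarith [(le_abs_self _).trans (hB q hqL)]

theorem IsWeakSolution.eq_zero_of_kellerOsserman {g h : ℝ → ℝ} {u : Heis m → ℝ} (hp : 1 < p)
    (hF : CondF f) (hH : CondH h) (hL1 : IntegrableOn h (Ioi 0)) (hG : CondG (phiP p) 0 g)
    (hKO : KellerOsserman (phiP p) f) (hu : IsWeakSolution (phiP p) f h g u)
    (hu0 : ∀ q, 0 ≤ u q) (q : Heis m) : u q = 0 := by
  obtain ⟨M, hM, v, hv, huv⟩ := hu.exists_isPosSubsolution hp hF hH hL1 hG hu0
  have hvq := hv.eq_zero_of_kellerOsserman hp (hF.comp_div hM) (hKO.comp_div hp hF hM) q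
  exact le_antisymm ((huv q).trans_eq hvq) (hu0 q)

end Liouville

section Flow

lemma exists_orderIso_of_hasDerivAt_pos {G k : ℝ → ℝ} (hG : ∀ x, HasDerivAt G (k x) x)
    (hk : ∀ x, 0 < k x) (htop : Tendsto G atTop atTop) (hbot : Tendsto G atBot atBot) :
    ∃ e : ℝ ≃o ℝ, ⇑e = G :=
  have hcont : Continuous G := continuous_iff_continuousAt.2 fun x => (hG x).continuousAt
  ⟨(strictMono_of_hasDerivAt_pos hG hk).orderIsoOfSurjective G (hcont.surjective htop hbot), rfl⟩

lemma hasDerivAt_orderIso_symm (e : ℝ ≃o ℝ) {k y : ℝ} (he : HasDerivAt e k (e.symm y))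
    (hk : k ≠ 0) : HasDerivAt e.symm k⁻¹ y :=
  he.of_local_left_inverse e.symm.continuous.continuousAt hk (.of_forall e.apply_symm_apply)

lemma exists_orderIso_of_le_deriv {k : ℝ → ℝ} (hk : Continuous k) {c : ℝ} (hc : 0 < c)
    (hck : ∀ x, c ≤ k x) (a : ℝ) : ∃ e : ℝ ≃o ℝ, e a = 0 ∧ ∀ x, HasDerivAt e (k x) x := by
  have hG : ∀ x, HasDerivAt (fun x => ∫ t in a..x, k t) (k x) x := fun x =>
    hk.integral_hasStrictDerivAt a x |>.hasDerivAt
  have hmono : Monotone fun x => (∫ t in a..x, k t) - c * x :=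
    monotone_of_hasDerivAt_nonneg (fun x => (hG x).sub ((hasDerivAt_id x).const_mul c))
      fun x => by simpa using hck x
  have hright : ∀ x, a ≤ x → c * x - c * a ≤ ∫ t in a..x, k t := fun x hx => by
    have := hmono hx
    simp only [intervalIntegral.integral_same] at this
    linarith
  have hleft : ∀ x, x ≤ a → ∫ t in a..x, k t ≤ c * x - c * a := fun x hx => by
    have := hmono hx
    simp only [intervalIntegral.integral_same] at this
    linarith
  obtain ⟨e, he⟩ := exists_orderIso_of_hasDerivAt_pos hG (fun x => hc.trans_le (hck x))
    (tendsto_atTop_mono' _ ((eventually_ge_atTop a).mono hright)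
      (tendsto_atTop_add_const_right _ _ (tendsto_id.const_mul_atTop hc)))
    (tendsto_atBot_mono' _ ((eventually_le_atBot a).mono hleft)
      (tendsto_atBot_add_const_right _ _ (tendsto_id.const_mul_atBot hc)))
  exact ⟨e, by simp [he], by simpa only [he] using hG⟩

lemma exists_surjective_hasDerivAt {Γ : ℝ → ℝ} (hΓ : Continuous Γ) (hpos : ∀ v, 0 < Γ v)
    (heven : ∀ v, Γ (-v) = Γ v)
    (htop : Tendsto (fun v => ∫ t in (0 : ℝ)..v, (Γ t)⁻¹) atTop atTop) :
    ∃ V : ℝ → ℝ, Function.Surjective V ∧ ∀ x, HasDerivAt V (Γ (V x)) x := by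
  have hG : ∀ v, HasDerivAt (fun v => ∫ t in (0 : ℝ)..v, (Γ t)⁻¹) (Γ v)⁻¹ v := fun v =>
    ((hΓ.inv₀ fun t => (hpos t).ne').integral_hasStrictDerivAt 0 v).hasDerivAt
  have hodd : ∀ v, -∫ t in (0 : ℝ)..-v, (Γ t)⁻¹ = ∫ t in (0 : ℝ)..v, (Γ t)⁻¹ := fun v => by
    rw [← intervalIntegral.integral_symm, ← neg_zero, ← intervalIntegral.integral_comp_neg]
    simp only [heven, neg_zero]
  have hbot : Tendsto (fun v => ∫ t in (0 : ℝ)..v, (Γ t)⁻¹) atBot atBot :=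
    (tendsto_neg_atTop_atBot.comp (htop.comp tendsto_neg_atBot_atTop)).congr hodd
  obtain ⟨e, he⟩ := exists_orderIso_of_hasDerivAt_pos hG (fun v => inv_pos.2 (hpos v)) htop hbot
  refine ⟨e.symm, e.symm.surjective, fun x => ?_⟩
  have hd : HasDerivAt e (Γ (e.symm x))⁻¹ (e.symm x) := by simpa only [he] using hG (e.symm x)
  simpa using hasDerivAt_orderIso_symm e hd (inv_pos.2 (hpos _)).ne'

end Flow

section Profile

variable {p q : ℝ} {f : ℝ → ℝ}

/- `e` is a primitive of `f` vanishing at `1`, continued to the left of `1` with slope `f 1` so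
that it is a bijection of the line. -/
lemma CondF.exists_orderIso_hasDerivAt (hF : CondF f) :
    ∃ e : ℝ ≃o ℝ, e 1 = 0 ∧ ∀ s, HasDerivAt e (f (max s 1)) s := by
  have hle : ∀ s : ℝ, 0 ≤ max s 1 := fun s => zero_le_one.trans (le_max_right s 1)
  exact exists_orderIso_of_le_deriv
    (hF.continuousOn.comp_continuous (continuous_id.max continuous_const) hle)
    (hF.pos 1 one_pos) (fun s => hF.monotoneOn (zero_le_one' ℝ) (hle s) (le_max_right s 1)) 1

lemma CondF.primF_eq_add_orderIso (hF : CondF f) {e : ℝ ≃o ℝ} (he1 : e 1 = 0)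
    (he : ∀ s, HasDerivAt e (f (max s 1)) s) {s : ℝ} (hs : 1 ≤ s) :
    primF f s = primF f 1 + e s := by
  have hint : IntervalIntegrable f volume 1 s :=
    hF.intervalIntegrable zero_le_one (zero_le_one.trans hs)
  have htail : ∫ t in (1 : ℝ)..s, f t = e s := by
    rw [intervalIntegral.integral_eq_sub_of_hasDerivAt (f := e) (fun t ht => ?_) hint, he1,
      sub_zero]
    rw [uIcc_of_le hs] at ht
    simpa only [max_eq_left ht.1] using he t
  rw [← htail]
  exact (intervalIntegral.integral_add_adjacent_intervals
    (hF.intervalIntegrable le_rfl zero_le_one) hint).symm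

lemma kellerOsserman_of_integrableOn_orderIso (hp : 1 < p) (hq : 0 < q) (hF : CondF f)
    {e : ℝ ≃o ℝ} (he1 : e 1 = 0) (he : ∀ s, HasDerivAt e (f (max s 1)) s)
    (hint : IntegrableOn (fun s => (q * e s) ^ (-p⁻¹)) (Ioi 1)) :
    KellerOsserman (phiP p) f := by
  have hprim : ∀ s ∈ Ioi (1 : ℝ), primF f s = primF f 1 + e s := fun s hs =>
    hF.primF_eq_add_orderIso he1 he (le_of_lt hs)
  have hmeas : ContinuousOn (fun s => primF f s ^ (-p⁻¹)) (Ioi 1) :=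
    ((continuous_const.add e.continuous).continuousOn.congr hprim).rpow_const fun s hs =>
      Or.inl (hF.primF_pos (one_pos.trans hs)).ne'
  refine (kellerOsserman_phiP_iff hp hF).2 ⟨1, one_pos, (hint.const_mul (q ^ p⁻¹)).mono'
    (hmeas.aestronglyMeasurable measurableSet_Ioi)
    ((ae_restrict_iff' measurableSet_Ioi).2 (.of_forall fun s hs => ?_))⟩
  have hes : 0 < e s := he1 ▸ e.strictMono hs
  have hF0 : 0 < primF f s := hF.primF_pos (one_pos.trans hs)
  rw [Real.norm_of_nonneg (Real.rpow_nonneg hF0.le _), Real.mul_rpow hq.le hes.le, ← mul_assoc,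
    ← Real.rpow_add hq, add_neg_cancel, Real.rpow_zero, one_mul]
  refine Real.rpow_le_rpow_of_nonpos hes ?_ (neg_nonpos.2 (inv_nonneg.2 (by linarith)))
  rw [hprim s hs]
  exact le_add_of_nonneg_left (hF.primF_pos one_pos).le

/- Substituting `v ^ q / q = e s`, that is `v = (q e(s)) ^ (1 / q)`, turns `dv / f(s)` into
`(q e(s)) ^ (-1 / p) ds`. -/
lemma tendsto_integral_inv_of_not_kellerOsserman (hpq : p.HolderConjugate q) (hF : CondF f)
    {e : ℝ ≃o ℝ} (he1 : e 1 = 0) (he : ∀ s, HasDerivAt e (f (max s 1)) s)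
    (hc : Continuous fun v : ℝ => f (e.symm (|v| ^ q / q)))
    (hpos : ∀ v : ℝ, 0 < f (e.symm (|v| ^ q / q))) (hKO : ¬ KellerOsserman (phiP p) f) :
    Tendsto (fun v => ∫ t in (0 : ℝ)..v, (f (e.symm (|t| ^ q / q)))⁻¹) atTop atTop := by
  have hq0 : 0 < q := hpq.symm.pos
  set G : ℝ → ℝ := fun v => ∫ t in (0 : ℝ)..v, (f (e.symm (|t| ^ q / q)))⁻¹
  have hG : ∀ v, HasDerivAt G (f (e.symm (|v| ^ q / q)))⁻¹ v := fun v =>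
    ((hc.inv₀ fun t => (hpos t).ne').integral_hasStrictDerivAt 0 v).hasDerivAt
  refine (tendsto_atTop_of_monotone (strictMono_of_hasDerivAt_pos hG
    fun v => inv_pos.2 (hpos v)).monotone).resolve_right fun ⟨l, hl⟩ => hKO ?_
  have hqe : ∀ s, 1 < s → 0 < q * e s := fun s hs => mul_pos hq0 (he1 ▸ e.strictMono hs)
  have hsub : ∀ s ∈ Ioi (1 : ℝ), HasDerivAt (fun s => G ((q * e s) ^ q⁻¹))
      ((q * e s) ^ (-p⁻¹)) s := fun s hs => by
    have hqes := hqe s hs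
    refine ((hG _).comp s (((he s).const_mul q).rpow_const (Or.inl hqes.ne'))).congr_deriv ?_
    rw [abs_of_nonneg (by positivity), Real.rpow_inv_rpow hqes.le hq0.ne',
      mul_div_cancel_left₀ _ hq0.ne', e.symm_apply_apply, max_eq_left (le_of_lt hs),
      show q⁻¹ - 1 = -p⁻¹ by linarith [hpq.inv_add_inv_eq_one]]
    have := hF.pos s (one_pos.trans hs)
    field_simp
  have hcont : ContinuousWithinAt (fun s => G ((q * e s) ^ q⁻¹)) (Ici 1) 1 := by
    have : Continuous G := continuous_iff_continuousAt.2 fun v => (hG v).continuousAt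
    exact (this.comp ((continuous_const.mul e.continuous).rpow_const fun _ =>
      Or.inr (inv_nonneg.2 hq0.le))).continuousWithinAt
  have hlim : Tendsto (fun s => G ((q * e s) ^ q⁻¹)) atTop (𝓝 l) :=
    hl.comp ((tendsto_rpow_atTop (inv_pos.2 hq0)).comp (e.tendsto_atTop.const_mul_atTop hq0))
  exact kellerOsserman_of_integrableOn_orderIso hpq.lt hq0 hF he1 he
    (integrableOn_Ioi_deriv_of_nonneg hcont hsub
      (fun s hs => Real.rpow_nonneg (hqe s hs).le _) hlim)

/- The first integral `|V| ^ q / q = e(w)` of the system `w' = flux V`, `V' = f(w)` reduces it to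
the scalar equation `V' = Γ(V)`, whose solutions are global exactly when the integral of `1 / Γ`
diverges. -/
lemma exists_profile (hpq : p.HolderConjugate q) (hF : CondF f)
    (hKO : ¬ KellerOsserman (phiP p) f) :
    ∃ w V : ℝ → ℝ, (∀ x, HasDerivAt w (flux (phiP q) (V x)) x) ∧
      (∀ x, HasDerivAt V (f (w x)) x) ∧ (∀ x, 1 ≤ w x) ∧ ¬ ∃ c, ∀ x, w x = c := by
  have hq0 : 0 < q := hpq.symm.pos
  obtain ⟨e, he1, he⟩ := hF.exists_orderIso_hasDerivAt
  have hle : ∀ v : ℝ, 1 ≤ e.symm (|v| ^ q / q) := fun v => by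
    rw [e.le_symm_apply, he1]
    positivity
  have hpos : ∀ v : ℝ, 0 < f (e.symm (|v| ^ q / q)) := fun v =>
    hF.pos _ (one_pos.trans_le (hle v))
  have hΓ : Continuous fun v : ℝ => f (e.symm (|v| ^ q / q)) :=
    hF.continuousOn.comp_continuous (e.symm.continuous.comp
      ((continuous_abs.rpow_const fun _ => Or.inr hq0.le).div_const q))
      fun v => zero_le_one.trans (hle v)
  obtain ⟨V, hVsurj, hV⟩ := exists_surjective_hasDerivAt hΓ hpos (fun v => by simp)
    (tendsto_integral_inv_of_not_kellerOsserman hpq hF he1 he hΓ hpos hKO)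
  refine ⟨fun x => e.symm (|V x| ^ q / q), V, fun x => ?_, hV, fun x => hle _, ?_⟩
  · have hsymm : HasDerivAt e.symm (f (e.symm (|V x| ^ q / q)))⁻¹ (|V x| ^ q / q) := by
      refine hasDerivAt_orderIso_symm e ?_ (hpos _).ne'
      simpa only [max_eq_left (hle (V x))] using he (e.symm (|V x| ^ q / q))
    refine (hsymm.comp x (((hasDerivAt_abs_rpow (V x) hpq.symm.lt).comp x (hV x)).div_const
      q)).congr_deriv ?_
    rw [flux_phiP_eq_smul, Real.norm_eq_abs, smul_eq_mul]
    have := hpos (V x)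
    field_simp
  · rintro ⟨c, hcw⟩
    obtain ⟨x₀, hx₀⟩ := hVsurj 0
    obtain ⟨x₁, hx₁⟩ := hVsurj 1
    have := e.symm.injective ((hcw x₀).trans (hcw x₁).symm)
    simp [hx₀, hx₁, hq0.ne, hq0.ne'] at this

end Profile

lemma flux_single {ι : Type*} [Fintype ι] [DecidableEq ι] (φ : ℝ → ℝ) (i : ι) (x : ℝ) :
    flux φ (EuclideanSpace.single i x) = EuclideanSpace.single i (flux φ x) := by
  rw [flux, flux, PiLp.norm_single]
  ext k
  by_cases hk : k = i <;> simp [hk]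

section Existence

variable {m : ℕ}

lemma divergence_frame (a : EuclideanSpace ℝ (Fin m ⊕ Fin m)) (q : Heis m) :
    divergence (fun q => frame q a) q = 0 := by
  let L : Heis m →L[ℝ] Heis m := ContinuousLinearMap.prod 0 (ContinuousLinearMap.prod 0
    ((2 : ℝ) • ∑ j, (a (Sum.inl j) • coordY j - a (Sum.inr j) • coordX j)))
  have haffine : (fun q : Heis m => frame q a) = fun q =>
      (fun j => a (Sum.inl j), fun j => a (Sum.inr j), 0) + L q := by
    funext q
    simp [frame, L, mul_comm]
  rw [divergence_heis, haffine, (L.hasFDerivAt.const_add _).fderiv]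
  simp [L]

lemma isWeakSolution_of_le_divergence {φ f h g : ℝ → ℝ} {u : Heis m → ℝ} (hu : ContDiff ℝ 1 u)
    (hW : ContDiff ℝ 1 fun q => frame q (flux φ (gradH u q)))
    (hrhs : Continuous fun q => f (u q) - h (u q) * g ‖gradH u q‖)
    (hle : ∀ q, f (u q) - h (u q) * g ‖gradH u q‖ ≤
      divergence (fun q => frame q (flux φ (gradH u q))) q) :
    IsWeakSolution φ f h g u := by
  refine ⟨hu, hrhs.locallyIntegrable, fun ζ hζ hc hζ0 => ?_⟩
  have hflux : ∀ q, ‖gradH u q‖⁻¹ * φ ‖gradH u q‖ * inner ℝ (gradH u q) (gradH ζ q) =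
      fderiv ℝ ζ q (frame q (flux φ (gradH u q))) := fun q => by
    rw [← inner_horiz, ← gradH_eq_horiz, flux, real_inner_smul_left]
  simp_rw [hflux]
  rw [integral_fderiv_apply_eq_neg_integral_divergence_mul volume hW (hζ.of_le (by simp)) hc,
    neg_neg]
  exact integral_mono
    ((hrhs.mul hζ.continuous).integrable_of_hasCompactSupport hc.mul_left)
    (((continuous_divergence hW).mul hζ.continuous).integrable_of_hasCompactSupport hc.mul_left)
    fun q => mul_le_mul_of_nonneg_right (hle q) (hζ0 q)

lemma gradH_comp_coordX {w : ℝ → ℝ} {w' : ℝ} {j : Fin m} {q : Heis m}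
    (hw : HasDerivAt w w' (q.1 j)) :
    gradH (fun q => w (q.1 j)) q = EuclideanSpace.single (Sum.inl j) w' := by
  have hd : HasFDerivAt (fun q : Heis m => w (q.1 j)) (w' • coordX j) q :=
    hw.comp_hasFDerivAt q (coordX j).hasFDerivAt
  rw [gradH_eq_of_hasFDerivAt hd]
  ext (i | i)
  · by_cases hij : i = j
    · simp [horiz, hij]
    · simp [horiz, hij, Ne.symm hij]
  · simp [horiz]

lemma divergence_smul_frame_single {V : ℝ → ℝ} {V' : ℝ} {j : Fin m} {q : Heis m}
    (hV : HasDerivAt V V' (q.1 j)) :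
    divergence (fun q => V (q.1 j) • frame q (EuclideanSpace.single (Sum.inl j) 1)) q = V' := by
  have hd : HasFDerivAt (fun q : Heis m => V (q.1 j)) (V' • coordX j) q :=
    hV.comp_hasFDerivAt q (coordX j).hasFDerivAt
  rw [divergence_smul hd.differentiableAt (by unfold frame; fun_prop), divergence_frame, hd.fderiv]
  simp [frame]

lemma isWeakSolution_comp_coordX {p r : ℝ} (hpr : p.HolderConjugate r) {f h g w V : ℝ → ℝ}
    (hF : CondF f) (hH : CondH h) (hg : ContinuousOn g (Ici 0)) (hg0 : ∀ t, 0 ≤ t → 0 ≤ g t)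
    (hw : ∀ x, HasDerivAt w (flux (phiP r) (V x)) x) (hV : ∀ x, HasDerivAt V (f (w x)) x)
    (hwpos : ∀ x, 0 < w x) (j : Fin m) :
    IsWeakSolution (phiP p) f h g fun q : Heis m => w (q.1 j) := by
  have hcoord : ContDiff ℝ 1 fun q : Heis m => q.1 j := (coordX j).contDiff
  have hwc : Continuous w := continuous_iff_continuousAt.2 fun x => (hw x).continuousAt
  have hVc : Continuous V := continuous_iff_continuousAt.2 fun x => (hV x).continuousAt
  have hfw : Continuous fun x => f (w x) :=
    hF.continuousOn.comp_continuous hwc fun x => (hwpos x).le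
  have hw' : Continuous fun x => flux (phiP r) (V x) := (continuous_flux_phiP hpr.symm.lt).comp hVc
  have hgrad : ∀ q : Heis m, gradH (fun q => w (q.1 j)) q =
      EuclideanSpace.single (Sum.inl j) (flux (phiP r) (V (q.1 j))) := fun q =>
    gradH_comp_coordX (hw _)
  have hfield : (fun q : Heis m => frame q (flux (phiP p) (gradH (fun q => w (q.1 j)) q))) =
      fun q => V (q.1 j) • frame q (EuclideanSpace.single (Sum.inl j) 1) := by
    funext q
    rw [hgrad, flux_single, flux_phiP_flux_phiP hpr]
    refine Prod.ext ?_ (Prod.ext ?_ ?_) <;> [ext i; ext i; skip] <;>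
      simp [frame, mul_left_comm, mul_comm]
  refine isWeakSolution_of_le_divergence ?_ ?_ ?_ fun q => ?_
  · exact (contDiff_one_of_hasDerivAt hw hw').comp hcoord
  · rw [hfield]
    exact ((contDiff_one_of_hasDerivAt hV hfw).comp hcoord).smul (by unfold frame; fun_prop)
  · simp only [hgrad, PiLp.norm_single]
    exact (hfw.comp hcoord.continuous).sub <|
      (hH.continuousOn.comp_continuous (hwc.comp hcoord.continuous) fun q => hwpos _).mul <|
        hg.comp_continuous (hw'.comp hcoord.continuous).norm fun q => norm_nonneg _
  · rw [hfield, divergence_smul_frame_single (hV _)]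
    exact sub_le_self _ (mul_nonneg (hH.nonneg _ (hwpos _)) (hg0 _ (norm_nonneg _)))

end Existence

end HeisenbergKO

theorem mainTheorem5 (m : ℕ) (hm : 1 ≤ m) (p : ℝ) (hp : 1 < p) (f h g : ℝ → ℝ)
    (hF : CondF f) (hH : CondH h)
    (hg : ContinuousOn g (Ici 0)) (hg_nonneg : ∀ t, 0 ≤ t → 0 ≤ g t)
    (hG : CondG (phiP p) 0 g) (hPhi2 : CondPhi2 (phiP p) 0) (hPhi3 : CondPhi3 (phiP p))
    (hL1 : IntegrableOn h (Ioi 0) volume) :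
    (∃ u : Heis m → ℝ, IsWeakSolution (phiP p) f h g u ∧ (∀ q, 0 ≤ u q) ∧
      ¬ ∃ c : ℝ, ∀ q, u q = c) ↔
    ¬ KellerOsserman (phiP p) f := by
  constructor
  · rintro ⟨u, hu, hu0, hne⟩ hKO
    exact hne ⟨0, hu.eq_zero_of_kellerOsserman hp hF hH hL1 hG hKO hu0⟩
  · intro hKO
    have hpq := Real.HolderConjugate.conjExponent hp
    obtain ⟨w, V, hw, hV, hw1, hne⟩ := exists_profile hpq hF hKO
    have hwpos : ∀ x, 0 < w x := fun x => one_pos.trans_le (hw1 x)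
    refine ⟨_, isWeakSolution_comp_coordX hpq hF hH hg hg_nonneg hw hV hwpos ⟨0, hm⟩,
      fun q => (hwpos _).le, ?_⟩
    rintro ⟨c, hc⟩
    exact hne ⟨c, fun x => hc (fun _ => x, 0, 0)⟩
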